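/- Let $\mathbb K\in\{\mathbb R,\mathbb C\}$, let $E\neq\{0\}$ be a separable Fréchet space over $\mathbb K$ (topology given by an increasing sequence of seminorms), and let $\Delta$ be $[0,\infty)$, $\mathbb R$, $\mathbb C$ or a sector $\Delta(\alpha)=\{re^{i\theta}: r\ge 0,\ \theta\in[-\alpha,\alpha]\}$ with $\alpha\in(0,\pi/2]$. Let $m(\cdot)$ be Lebesgue measure on $\Delta$ (one-dimensional for $[0,\infty)$ and $\mathbb R$, planar for $\mathbb C$ and $\Delta(\alpha)$) and $\Delta_r=\{t\in\Delta:|t|\le r\}$. Let $(T(t))_{t\in\Delta}$ be a $C_0$-semigroup on $E$: each $T(t)$ is a continuous linear operator on $E$, $T(0)=I$, $T(t+s)=T(t)T(s)$ for $t,s\in\Delta$, and $t\mapsto T(t)x$ is continuous on $\Delta$ for every $x\in E$. Let $f:[0,\infty)\to[1,\infty)$ be increasing (not necessarily strictly) and $m_k=f(k)$ for $k\in\mathbb N_0$. With $\mathbb N=\{1,2,\dots\}$ put $$A^f_{k,n}=[\lfloor m_{k+n}\rfloor-\lfloor m_k\rfloor-1,\ \lfloor m_{k+n}\rfloor-\lfloor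 m_k\rfloor]\quad(k,n\in\mathbb N),$$ $$B^f_{k,n}=[\lfloor m_k\rfloor-\lfloor m_{k-n}\rfloor,\ \lfloor m_k\rfloor-\lfloor m_{k-n}\rfloor+1]\quad(k,n\in\mathbb N,\ k\ge n).$$ Terminology. $(T(t))_{t\in\Delta}$ is $f$-frequently hypercyclic if there is $x\in E$ such that for every non-empty open $V\subseteq E$, with $A=\{t\in\Delta:T(t)x\in V\}$, $$\liminf_{t\to\infty}\frac{m(A\cap\Delta_{f(t)})}{t}>0 .$$ A continuous linear operator $L$ on $E$ is l-$(m_k)$-frequently hypercyclic if there is $x\in E$ such that for every non-empty open $V\subseteq E$, $$\liminf_{k\to\infty}\frac{|\{n\in\mathbb N: L^nx\in V\}\cap[1,m_k]|}{k}>0 .$$ Series $\sum_n x_{n,k}$ ($k\in J$) converge unconditionally, uniformly in $k\in J$, if for every neighbourhood $U$ of $0$ in $E$ there is $N\in\mathbb N$ such that $\sum_{n\in F}x_{n,k}\in U$ for every finite $F\subseteq[N,\infty)\cap\mathbb N$ and every $k\in J$; for finite sums $\sum_{n=1}^k x_{n,k}$ put $x_{n,k}=0$ for $n>k$. Integrals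 are Bochner integrals in $E$. Suppose that there are a dense subset $E_0$ of $E$ with $T(t)E_0\subseteq E_0$ for all $t\in\Delta$ and (not necessarily linear) mappings $S(t):E_0\to E_0$ $(t\in\Delta)$ such that: (i) $T(t)S(t)x=x$ for $x\in E_0$, $t\in\Delta$, and $S(r)T(t)x=T(t)S(r)x=S(r-t)x$ for $x\in E_0$ whenever $r,t\in\Delta\setminus\{0\}$, $\arg(r)=\arg(t)$ and $|r|>|t|$; (ii) for every $t_0\in\Delta\setminus\{0\}$, $s\ge 0$ and $x\in E_0$, the sums $\sum_{n=1}^{k}\int_{s+B^f_{k,n}}T(tt_0)x\,dt$ converge unconditionally, uniformly in $k\in\mathbb N$; (iii) for every $t_0\in\Delta\setminus\{0\}$ and $x\in E_0$, the mapping $t\mapsto S(tt_0)x$ is Bochner integrable on $\tilde A_{k,n}=\{t\in A^f_{k,n}: tt_0\in\Delta\}$ for all $k,n\in\mathbb N$, and the series $\sum_{n=1}^{\infty}\int_{\tilde A_{k,n}}S(tt_0)x\,dt$ converge unconditionally, uniformly in $k\in\mathbb N$. Then $(T(t))_{t\in\Delta}$ is $f$-frequently hypercyclic and, for every $t_0\in\Delta\setminus\{0\}$,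 the semigroup $(T(te^{i\arg(t_0)}))_{t\ge0}$ (with index set $[0,\infty)$) is $f$-frequently hypercyclic and the operator $T(t_0)$ is l-$(m_k)$-frequently hypercyclic. -/

import Mathlib

open MeasureTheory Filter Topology Set
open scoped ENNReal

noncomputable section

/-- The admissible index sets: `[0,∞)`, `ℝ`, `ℂ`, and the closed sectors
`Δ(α) = {r e^{iθ} : r ≥ 0, θ ∈ [-α, α]}` with `0 < α ≤ π/2`. -/
inductive ComplexSector : Type
  | halfLine : ComplexSector
  | line : ComplexSector
  | plane : ComplexSector
  | sector (α : ℝ) (hα : 0 < α ∧ α ≤ Real.pi / 2) : ComplexSector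

namespace ComplexSector

/-- The index set as a subset of `ℂ`. -/
def carrier : ComplexSector → Set ℂ
  | halfLine => {z | ∃ t : ℝ, 0 ≤ t ∧ z = t}
  | line => {z | ∃ t : ℝ, z = t}
  | plane => Set.univ
  | sector α _ =>
      {z | ∃ r θ : ℝ, 0 ≤ r ∧ -α ≤ θ ∧ θ ≤ α ∧ z = r * Complex.exp (θ * Complex.I)}

/-- Lebesgue measure on the index set: the one-dimensional one for `[0,∞)` and `ℝ`,
the planar one for `ℂ` and the sectors. -/
def measure : ComplexSector → Measure ℂ
  | halfLine => Measure.map Complex.ofReal (volume.restrict (Set.Ici (0 : ℝ)))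
  | line => Measure.map Complex.ofReal (volume : Measure ℝ)
  | plane => volume
  | sector α hα => volume.restrict (sector α hα).carrier

/-- The truncation `Δ_r = {t ∈ Δ : |t| ≤ r}`. -/
def truncation (Δ : ComplexSector) (r : ℝ) : Set ℂ :=
  {z | z ∈ Δ.carrier ∧ ‖z‖ ≤ r}

/-- The lower `f`-density `liminf_{t → ∞} m(A ∩ Δ_{f(t)}) / t`, as an extended
nonnegative number. -/
def lowerDensity (Δ : ComplexSector) (f : ℝ → ℝ) (A : Set ℂ) : ℝ≥0∞ :=
  liminf (fun t : ℝ => Δ.measure (A ∩ Δ.truncation (f t)) / ENNReal.ofReal t) atTop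

end ComplexSector

/-- The lower `(m_n)`-density `liminf_{n → ∞} |A ∩ [1, m_n]| / n` of a set of positive
integers, as an extended nonnegative number. -/
def lowerSeqDensity (m : ℕ → ℝ) (A : Set ℕ) : ℝ≥0∞ :=
  liminf (fun n : ℕ => (({j ∈ A | 1 ≤ j ∧ (j : ℝ) ≤ m n}.ncard : ℕ) : ℝ≥0∞) / (n : ℝ≥0∞)) atTop

section Space

variable {𝕜 : Type*} [RCLike 𝕜] {E : Type*} [AddCommGroup E] [Module 𝕜 E]
  [TopologicalSpace E]

/-- A strongly continuous semigroup `(T(t))_{t ∈ Δ}` of continuous linear operators; the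
values of `T` off `Δ` are irrelevant. -/
structure IsC0Semigroup (Δ : ComplexSector) (T : ℂ → E →L[𝕜] E) : Prop where
  map_zero : T 0 = ContinuousLinearMap.id 𝕜 E
  map_add : ∀ t ∈ Δ.carrier, ∀ s ∈ Δ.carrier, T (t + s) = (T t).comp (T s)
  continuousOn : ∀ x : E, ContinuousOn (fun t => T t x) Δ.carrier

/-- `f`-frequent hypercyclicity of `(T(t))_{t ∈ Δ}`. -/
def IsFFrequentlyHypercyclic (Δ : ComplexSector) (f : ℝ → ℝ) (T : ℂ → E →L[𝕜] E) : Prop :=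
  ∃ x : E, ∀ V : Set E, IsOpen V → V.Nonempty →
    0 < Δ.lowerDensity f {t | t ∈ Δ.carrier ∧ T t x ∈ V}

/-- l-`(m_n)`-frequent hypercyclicity of a single operator. -/
def IsLFrequentlyHypercyclic (m : ℕ → ℝ) (A : E →L[𝕜] E) : Prop :=
  ∃ x : E, ∀ V : Set E, IsOpen V → V.Nonempty →
    0 < lowerSeqDensity m {n | (A ^ n) x ∈ V}

/-- Unconditional convergence of the series `∑_{n ≥ 1} x n k`, uniformly in `k ∈ J`: the
finite partial sums over index sets contained in `[N, ∞)` are small, uniformly in `k`. -/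
def UnconditionallyConvergentUniformly {ι : Type*} (J : Set ι) (x : ℕ → ι → E) : Prop :=
  ∀ U ∈ 𝓝 (0 : E), ∃ N : ℕ, 1 ≤ N ∧ ∀ F : Finset ℕ, (∀ n ∈ F, N ≤ n) →
    ∀ k ∈ J, ∑ n ∈ F, x n k ∈ U

variable (𝕜)

/-- The integral `∑_v μ(φ = v) v` of a simple function. -/
def simpleFuncIntegral (μ : Measure ℝ) (φ : SimpleFunc ℝ E) : E :=
  ∑ v ∈ φ.range, ((μ.real (φ ⁻¹' {v}) : ℝ) : 𝕜) • v

/-- `y` is the Bochner integral of `g`: `g` is strongly measurable and there are integrable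
simple functions `φ j` with `∫ q(g - φ j) dμ → 0` for every continuous seminorm `q`, whose
integrals converge to `y`. -/
def HasBochnerIntegral (μ : Measure ℝ) (g : ℝ → E) (y : E) : Prop :=
  AEStronglyMeasurable g μ ∧ ∃ φ : ℕ → SimpleFunc ℝ E,
    (∀ j, (φ j).FinMeasSupp μ) ∧
    (∀ q : Seminorm 𝕜 E, Continuous q →
      Tendsto (fun j => ∫⁻ t, ENNReal.ofReal (q (g t - φ j t)) ∂μ) atTop (𝓝 0)) ∧
    Tendsto (fun j => simpleFuncIntegral 𝕜 μ (φ j)) atTop (𝓝 y)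

/-- Bochner integrability of `g` on the set `A ⊆ ℝ` with respect to Lebesgue measure. -/
def BochnerIntegrableOn (A : Set ℝ) (g : ℝ → E) : Prop :=
  ∃ y : E, HasBochnerIntegral 𝕜 (volume.restrict A) g y

open Classical in
/-- The Bochner integral `∫_A g(t) dt` (with value `0` if `g` is not Bochner integrable). -/
def bochnerIntegral (A : Set ℝ) (g : ℝ → E) : E :=
  if h : BochnerIntegrableOn 𝕜 A g then h.choose else 0

end Space

/-- `A^f_{k,n} = [⌊m_{k+n}⌋ - ⌊m_k⌋ - 1, ⌊m_{k+n}⌋ - ⌊m_k⌋]`, where `m_k = f(k)`. -/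
def intervalA (f : ℝ → ℝ) (k n : ℕ) : Set ℝ :=
  Set.Icc ((⌊f ((k + n : ℕ) : ℝ)⌋ : ℝ) - (⌊f (k : ℝ)⌋ : ℝ) - 1)
    ((⌊f ((k + n : ℕ) : ℝ)⌋ : ℝ) - (⌊f (k : ℝ)⌋ : ℝ))

/-- `s + B^f_{k,n}`, where `B^f_{k,n} = [⌊m_k⌋ - ⌊m_{k-n}⌋, ⌊m_k⌋ - ⌊m_{k-n}⌋ + 1]` and
`m_k = f(k)`; only used for `n ≤ k`. -/
def shiftedIntervalB (f : ℝ → ℝ) (s : ℝ) (k n : ℕ) : Set ℝ :=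
  Set.Icc (s + ((⌊f (k : ℝ)⌋ : ℝ) - (⌊f ((k - n : ℕ) : ℝ)⌋ : ℝ)))
    (s + ((⌊f (k : ℝ)⌋ : ℝ) - (⌊f ((k - n : ℕ) : ℝ)⌋ : ℝ) + 1))

end

/-!
The proof rests on the averages `Q x = ∫₀¹ T (t t₀) x dt`, `x ∈ E₀`. Applying `T t₀ ^ d` to `Q x`
gives the integral over `[d, d + 1]`, so hypothesis `h_B` says that the sums of
`T t₀ ^ (⌊m_k⌋ - ⌊m_{k-n}⌋) (Q x)` converge unconditionally, uniformly in `k`. Likewise the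
integrals of `S (t t₀) x` over `[d - 1, d]` are preimages of `Q x` under `T t₀ ^ d`, and hypothesis
`h_A` controls their sums. This is the input of a frequent hypercyclicity criterion along the
exponents `⌊m_k⌋` (`exists_frequently_hypercyclic_vector`): one adds up preimages, under
`T t₀ ^ ⌊m_k⌋`, of a dense sequence of averages, where `k` runs over disjoint sets of positive lower
density whose elements are far apart (`exists_separated_positions`).

Two points need an argument. The averages `Q x` are dense
(`IsRaySemigroup.denseRange_average`): with `Q'` the average at half speed and `R = T (t₀ / 2)` one
has `(1 + R) Q' = 2 Q`, and `Q' x ∓ R ^ d (Q' x)` is in the range of `Q`, so that hypothesis `h_B` for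
`t₀ / 2`, which makes `R ^ d (Q' x)` small for suitable `d`, puts `Q' x` into the closure of that
range; iterating, one reaches the averages at speed `2⁻ʲ`, which tend to the identity. And
`⌊m_k⌋` must not be constant on long intervals, which also follows from hypothesis `h_B`
(`exists_forall_lt_of_unconditionallyConvergentUniformly`), since a nonzero `Q x` cannot be a term
of arbitrarily large index.

Finally, frequent hypercyclicity of `T 1` passes to the whole semigroup, for every index set
(`IsC0Semigroup.isFFrequentlyHypercyclic`): by local equicontinuity, `T (n + z) x` stays in a given
open set for all small `z` in a fixed set of positive measure.

Integrals in `E` are handled through continuous linear functionals (`HasWeakIntegral`): a Bochner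
integral is also a weak integral, and weak integrals are unique by the Hahn–Banach theorem.
-/

open scoped Uniformity

noncomputable section

/-! ### Vector-valued integrals through the dual space -/

section WeakIntegral

variable {𝕜 : Type*} [RCLike 𝕜] {E : Type*} [AddCommGroup E] [Module 𝕜 E]

section Topological

variable [TopologicalSpace E]

variable (𝕜) in
/-- `y` is the weak (Pettis) integral of `g` over `A` with respect to Lebesgue measure: every
continuous linear functional `u` is integrable along `g`, with integral `u y`. -/
def HasWeakIntegral (A : Set ℝ) (g : ℝ → E) (y : E) : Prop :=
  ∀ u : StrongDual 𝕜 E, IntegrableOn (fun t => u (g t)) A ∧ ∫ t in A, u (g t) = u y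

theorem exists_dual_norm_eq_seminorm [PolynormableSpace 𝕜 E] {q : Seminorm 𝕜 E}
    (hq : Continuous q) (y : E) :
    ∃ u : StrongDual 𝕜 E, (∀ x, ‖u x‖ ≤ q x) ∧ ‖u y‖ = q y := by
  rcases eq_or_ne y 0 with rfl | hy
  · exact ⟨0, fun x => by simp, by simp⟩
  let e := LinearEquiv.toSpanNonzeroSingleton 𝕜 E y hy
  let f : Module.Dual 𝕜 (Submodule.span 𝕜 {y}) :=
    ((q y : ℝ) : 𝕜) • (e.symm : Submodule.span 𝕜 {y} →ₗ[𝕜] 𝕜)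
  have hf : ∀ c : 𝕜, ‖f (e c)‖ = q (c • y) := fun c => by
    simp [f, map_smul_eq_mul, norm_smul, abs_of_nonneg (apply_nonneg q y), mul_comm]
  have he : ∀ c : 𝕜, ((e c : Submodule.span 𝕜 {y}) : E) = c • y := fun c => rfl
  obtain ⟨u, hu, hle⟩ := Module.Dual.exists_continuous_extension_of_le_seminorm
    (Submodule.span 𝕜 {y}) f hq (fun x => by
      obtain ⟨c, rfl⟩ := e.surjective x
      rw [hf, he])
  refine ⟨u, hle, ?_⟩
  have h1 := hu (e 1)
  rw [he, one_smul] at h1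
  rw [h1, hf, one_smul]

namespace HasWeakIntegral

variable {A : Set ℝ} {g g' : ℝ → E} {y y' : E}

theorem unique [PolynormableSpace 𝕜 E] [T1Space E] (h : HasWeakIntegral 𝕜 A g y)
    (h' : HasWeakIntegral 𝕜 A g y') : y = y' := by
  by_contra hne
  obtain ⟨⟨q, hq⟩, hq0⟩ := (PolynormableSpace.withSeminorms 𝕜 E).separating_of_T1 (y - y')
    (sub_ne_zero.2 hne)
  obtain ⟨u, -, hu⟩ := exists_dual_norm_eq_seminorm hq (y - y')
  apply hq0
  rw [← hu, map_sub, ← (h u).2, ← (h' u).2, sub_self, norm_zero]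

theorem map {F : Type*} [AddCommGroup F] [Module 𝕜 F] [TopologicalSpace F]
    (h : HasWeakIntegral 𝕜 A g y) (L : E →L[𝕜] F) :
    HasWeakIntegral 𝕜 A (fun t => L (g t)) (L y) :=
  fun u => h (u.comp L)

theorem add (h : HasWeakIntegral 𝕜 A g y) (h' : HasWeakIntegral 𝕜 A g' y') :
    HasWeakIntegral 𝕜 A (fun t => g t + g' t) (y + y') := fun u => by
  simp only [map_add]
  exact ⟨(h u).1.add (h' u).1, by rw [integral_add (h u).1 (h' u).1, (h u).2, (h' u).2]⟩

theorem const_smul (h : HasWeakIntegral 𝕜 A g y) (c : 𝕜) :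
    HasWeakIntegral 𝕜 A (fun t => c • g t) (c • y) := fun u => by
  simp only [map_smul, smul_eq_mul]
  exact ⟨(h u).1.const_mul c, by rw [integral_const_mul, (h u).2]⟩

theorem sub (h : HasWeakIntegral 𝕜 A g y) (h' : HasWeakIntegral 𝕜 A g' y') :
    HasWeakIntegral 𝕜 A (fun t => g t - g' t) (y - y') := fun u => by
  simp only [map_sub]
  exact ⟨(h u).1.sub (h' u).1, by rw [integral_sub (h u).1 (h' u).1, (h u).2, (h' u).2]⟩

theorem seminorm_le [PolynormableSpace 𝕜 E] (h : HasWeakIntegral 𝕜 A g y)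
    (hA : volume A ≠ ∞) {q : Seminorm 𝕜 E} (hq : Continuous q) {C : ℝ}
    (hC : ∀ t ∈ A, q (g t) ≤ C) : q y ≤ C * volume.real A := by
  obtain ⟨u, hu, hy⟩ := exists_dual_norm_eq_seminorm hq y
  rw [← hy, ← (h u).2]
  exact norm_setIntegral_le_of_norm_le_const hA.lt_top fun t ht => (hu _).trans (hC t ht)

theorem comp_measurePreserving (h : HasWeakIntegral 𝕜 A g y) {e : ℝ → ℝ}
    (he : MeasurePreserving e volume volume) (he' : MeasurableEmbedding e) :
    HasWeakIntegral 𝕜 (e ⁻¹' A) (fun t => g (e t)) y := fun u =>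
  ⟨(he.integrableOn_comp_preimage he').2 (h u).1, by
    rw [← (h u).2]
    exact he.setIntegral_preimage_emb he' (fun t => u (g t)) A⟩

theorem comp_sub_right {a b : ℝ} (h : HasWeakIntegral 𝕜 (Icc a b) g y) (c : ℝ) :
    HasWeakIntegral 𝕜 (Icc (a + c) (b + c)) (fun t => g (t - c)) y := by
  have := h.comp_measurePreserving (measurePreserving_sub_right volume c)
    (measurableEmbedding_subRight c)
  simpa using this

theorem comp_sub_left {a b : ℝ} (h : HasWeakIntegral 𝕜 (Icc a b) g y) (c : ℝ) :
    HasWeakIntegral 𝕜 (Icc (c - b) (c - a)) (fun t => g (c - t)) y := by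
  have := h.comp_measurePreserving (Measure.measurePreserving_sub_left volume c)
    (Homeomorph.subLeft c).measurableEmbedding
  simpa using this

theorem congr_Ioc {a b : ℝ} (h : HasWeakIntegral 𝕜 (Icc a b) g y)
    (hg : ∀ t ∈ Ioc a b, g t = g' t) : HasWeakIntegral 𝕜 (Icc a b) g' y := fun u => by
  obtain ⟨h1, h2⟩ := h u
  rw [integrableOn_Icc_iff_integrableOn_Ioc] at h1 ⊢
  rw [integral_Icc_eq_integral_Ioc] at h2 ⊢
  have he : EqOn (fun t => u (g t)) (fun t => u (g' t)) (Ioc a b) := fun t ht => by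
    simp only [hg t ht]
  exact ⟨h1.congr_fun he measurableSet_Ioc, by
    rw [← h2]; exact (setIntegral_congr_fun measurableSet_Ioc he).symm⟩

end HasWeakIntegral

theorem integral_dual_simpleFunc {μ : Measure ℝ} {φ : SimpleFunc ℝ E} (hφ : φ.FinMeasSupp μ)
    (u : StrongDual 𝕜 E) :
    Integrable (fun t => u (φ t)) μ ∧ ∫ t, u (φ t) ∂μ = u (simpleFuncIntegral 𝕜 μ φ) := by
  classical
  have hi : ∀ v : E, Integrable ((φ ⁻¹' {v}).indicator fun _ => u v) μ := fun v => by
    by_cases hv : v = 0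
    · subst hv; simp
    · exact (integrable_indicator_iff (φ.measurableSet_fiber v)).2
        (integrableOn_const ((SimpleFunc.finMeasSupp_iff.1 hφ v hv).ne))
  have heq : (fun t => u (φ t)) =
      fun t => ∑ v ∈ φ.range, (φ ⁻¹' {v}).indicator (fun _ => u v) t := by
    funext t
    rw [Finset.sum_eq_single (φ t)]
    · simp
    · intro v _ hv
      simp [Ne.symm hv]
    · intro h
      exact absurd (φ.mem_range_self t) h
  rw [heq]
  refine ⟨integrable_finsetSum _ fun v _ => hi v, ?_⟩
  rw [integral_finsetSum _ fun v _ => hi v, simpleFuncIntegral, map_sum]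
  refine Finset.sum_congr rfl fun v _ => ?_
  rw [integral_indicator_const _ (φ.measurableSet_fiber v), map_smul, RCLike.real_smul_eq_coe_mul,
    smul_eq_mul]

theorem HasBochnerIntegral.hasWeakIntegral {A : Set ℝ} {g : ℝ → E} {y : E}
    (h : HasBochnerIntegral 𝕜 (volume.restrict A) g y) : HasWeakIntegral 𝕜 A g y := fun u => by
  obtain ⟨hg, φ, hφ, hq, hy⟩ := h
  have hlim : Tendsto (fun j => ∫⁻ t in A, ‖u (φ j t) - u (g t)‖ₑ) atTop (𝓝 0) := by
    refine (hq ((normSeminorm 𝕜 𝕜).comp u.toLinearMap) u.continuous.norm).congr fun j => ?_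
    refine lintegral_congr fun t => ?_
    rw [← ofReal_norm, norm_sub_rev]
    simp
  have hm : AEStronglyMeasurable (fun t => u (g t)) (volume.restrict A) :=
    u.continuous.comp_aestronglyMeasurable hg
  have hφi := fun j => (integral_dual_simpleFunc (hφ j) u).1
  have hint : IntegrableOn (fun t => u (g t)) A := by
    obtain ⟨j, hj⟩ := (hlim.eventually (gt_mem_nhds ENNReal.zero_lt_top)).exists
    have hd : Integrable (fun t => u (φ j t) - u (g t)) (volume.restrict A) :=
      ⟨(hφi j).aestronglyMeasurable.sub hm, hj⟩
    exact ((hφi j).sub hd).congr (Eventually.of_forall fun t => by simp)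
  refine ⟨hint, tendsto_nhds_unique
    (tendsto_integral_of_L1 _ hm (Eventually.of_forall hφi) hlim) ?_⟩
  refine ((u.continuous.tendsto y).comp hy).congr fun j => ?_
  exact (integral_dual_simpleFunc (hφ j) u).2.symm

theorem BochnerIntegrableOn.hasWeakIntegral {A : Set ℝ} {g : ℝ → E}
    (h : BochnerIntegrableOn 𝕜 A g) : HasWeakIntegral 𝕜 A g (bochnerIntegral 𝕜 A g) := by
  rw [bochnerIntegral, dif_pos h]
  exact h.choose_spec.hasWeakIntegral

end Topological

section Uniform

variable [UniformSpace E] [IsUniformAddGroup E] [PolynormableSpace 𝕜 E]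
  [FirstCountableTopology E] [CompleteSpace E]

/-- The index of the cell containing `t` in the grid of mesh `1 / (n + 1)` that starts at `a`,
capped so that the grid point belongs to `[a, b]`. -/
def gridIndex (a b : ℝ) (n : ℕ) : SimpleFunc ℝ ℕ where
  toFun t := min ⌊((n : ℝ) + 1) * (t - a)⌋₊ ⌊((n : ℝ) + 1) * (b - a)⌋₊
  measurableSet_fiber' k := by
    have : Measurable fun t : ℝ => min ⌊((n : ℝ) + 1) * (t - a)⌋₊ ⌊((n : ℝ) + 1) * (b - a)⌋₊ := by
      fun_prop
    exact this (measurableSet_singleton k)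
  finite_range' := (Set.finite_Iic (⌊((n : ℝ) + 1) * (b - a)⌋₊ : ℕ)).subset (by
    rintro _ ⟨t, rfl⟩
    exact Nat.min_le_right _ _)

theorem gridIndex_spec {a b t : ℝ} (ht : t ∈ Icc a b) (n : ℕ) :
    a + gridIndex a b n t / ((n : ℝ) + 1) ∈ Icc a b ∧
      |t - (a + gridIndex a b n t / ((n : ℝ) + 1))| ≤ 1 / ((n : ℝ) + 1) := by
  have hn : (0 : ℝ) < n + 1 := by positivity
  have h0 : 0 ≤ ((n : ℝ) + 1) * (t - a) := mul_nonneg hn.le (sub_nonneg.2 ht.1)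
  have he : gridIndex a b n t = ⌊((n : ℝ) + 1) * (t - a)⌋₊ :=
    min_eq_left (Nat.floor_mono (by gcongr; exact ht.2))
  have h1 : (⌊((n : ℝ) + 1) * (t - a)⌋₊ : ℝ) / (n + 1) ≤ t - a := by
    rw [div_le_iff₀' hn]; exact Nat.floor_le h0
  have h2 : t - a ≤ (⌊((n : ℝ) + 1) * (t - a)⌋₊ : ℝ) / (n + 1) + 1 / (n + 1) := by
    rw [← add_div, le_div_iff₀' hn]; exact (Nat.lt_floor_add_one _).le
  have h3 : 0 ≤ (⌊((n : ℝ) + 1) * (t - a)⌋₊ : ℝ) / (n + 1) := by positivity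
  rw [he]
  refine ⟨⟨by linarith, by linarith [ht.2]⟩, ?_⟩
  rw [abs_le]
  constructor <;> linarith [show 0 ≤ 1 / ((n : ℝ) + 1) by positivity]

/-- Continuous functions on a compact interval are Bochner integrable: the step functions that
sample `g` on a fine grid converge uniformly to `g`, and their integrals form a Cauchy sequence. -/
theorem bochnerIntegrableOn_Icc {a b : ℝ} {g : ℝ → E} (hg : ContinuousOn g (Icc a b)) :
    BochnerIntegrableOn 𝕜 (Icc a b) g := by
  have hcg : (𝓤 E).IsCountablyGenerated := IsUniformAddGroup.uniformity_countably_generated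
  have hpm : TopologicalSpace.PseudoMetrizableSpace E := inferInstance
  let φ : ℕ → SimpleFunc ℝ E := fun n =>
    (gridIndex a b n).map fun k : ℕ => g (a + (k : ℝ) / ((n : ℝ) + 1))
  have hφ : ∀ q : Seminorm 𝕜 E, Continuous q → ∀ ε > 0, ∃ N : ℕ, ∀ n ≥ N, ∀ t ∈ Icc a b,
      q (g t - φ n t) ≤ ε := by
    intro q hq ε hε
    have hu := isCompact_Icc.uniformContinuousOn_of_continuous hg
    have hW : {x : E × E | q (x.2 - x.1) < ε} ∈ 𝓤 E := by
      rw [uniformity_eq_comap_nhds_zero]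
      exact preimage_mem_comap (m := fun x : E × E => x.2 - x.1) (t := {x | q x < ε})
        ((hq.tendsto' 0 0 (map_zero q)).eventually (gt_mem_nhds hε))
    have h1 := hu hW
    rw [mem_map, mem_inf_principal, Metric.mem_uniformity_dist] at h1
    obtain ⟨δ, hδ, h2⟩ := h1
    obtain ⟨N, hN⟩ := exists_nat_one_div_lt hδ
    refine ⟨N, fun n hn t ht => ?_⟩
    obtain ⟨h3, h4⟩ := gridIndex_spec ht n
    have h5 : dist (a + gridIndex a b n t / ((n : ℝ) + 1)) t < δ := by
      rw [dist_comm, Real.dist_eq]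
      refine (h4.trans ?_).trans_lt hN
      have : (N : ℝ) ≤ n := by exact_mod_cast hn
      gcongr
    exact (h2 h5 ⟨h3, ht⟩).le
  have hfin : ∀ n, (φ n).FinMeasSupp (volume.restrict (Icc a b)) := fun n =>
    SimpleFunc.finMeasSupp_iff.2 fun v _ => measure_lt_top _ _
  have hvol : volume (Icc a b) ≠ ∞ := by simp
  have hcauchy : CauchySeq fun n => simpleFuncIntegral 𝕜 (volume.restrict (Icc a b)) (φ n) := by
    have hb := (PolynormableSpace.withSeminorms 𝕜 E).hasBasis_zero_ball.uniformity_of_nhds_zero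
    rw [hb.cauchySeq_iff]
    rintro ⟨s, r⟩ hr
    have hs : Continuous
        ((s.sup fun p : {p : Seminorm 𝕜 E // Continuous p} => p.1 : Seminorm 𝕜 E) : E → ℝ) :=
      Seminorm.continuous_finsetSup fun p _ => p.2
    set q := s.sup fun p : {p : Seminorm 𝕜 E // Continuous p} => p.1
    have hr : 0 < r := hr
    have hV : 0 < 2 * (volume.real (Icc a b) + 1) := by positivity
    obtain ⟨N, hN⟩ := hφ q hs (r / (2 * (volume.real (Icc a b) + 1))) (by positivity)
    refine ⟨N, fun m hm n hn => ?_⟩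
    have hw := fun n => (show HasWeakIntegral 𝕜 (Icc a b) (φ n) _ from
      integral_dual_simpleFunc (hfin n))
    have hle := ((hw n).sub (hw m)).seminorm_le hvol hs
      (C := 2 * (r / (2 * (volume.real (Icc a b) + 1)))) fun t ht => by
        have e : φ n t - φ m t = (g t - φ m t) - (g t - φ n t) := by abel
        rw [e]
        refine (map_sub_le_add q _ _).trans ?_
        linarith [hN m hm t ht, hN n hn t ht]
    simp only [Seminorm.mem_ball_zero, mem_ofPred_eq]
    refine hle.trans_lt ?_
    have : 2 * (r / (2 * (volume.real (Icc a b) + 1))) = r / (volume.real (Icc a b) + 1) := by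
      field_simp
    rw [this, div_mul_eq_mul_div, div_lt_iff₀ (by positivity)]
    nlinarith
  obtain ⟨y, hy⟩ := cauchySeq_tendsto_of_complete hcauchy
  refine ⟨y, hg.aestronglyMeasurable measurableSet_Icc, φ, hfin, fun q hq => ?_, hy⟩
  rw [ENNReal.tendsto_atTop_zero]
  intro ε hε
  obtain ⟨c, hc0, hc⟩ : ∃ c : ℝ, 0 < c ∧ ENNReal.ofReal c * volume (Icc a b) ≤ ε := by
    have ht : Tendsto (fun c : ℝ => ENNReal.ofReal c * volume (Icc a b)) (𝓝[>] 0) (𝓝 0) := by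
      have h1 : Tendsto (fun c : ℝ => ENNReal.ofReal c) (𝓝[>] 0) (𝓝 0) := by
        simpa using (ENNReal.continuous_ofReal.tendsto 0).mono_left nhdsWithin_le_nhds
      simpa using ENNReal.Tendsto.mul_const h1 (Or.inr hvol)
    obtain ⟨c, hc, hc0⟩ := ((ht.eventually (ge_mem_nhds hε)).and self_mem_nhdsWithin).exists
    exact ⟨c, hc0, hc⟩
  obtain ⟨N, hN⟩ := hφ q hq c hc0
  refine ⟨N, fun n hn => ?_⟩
  calc ∫⁻ t in Icc a b, ENNReal.ofReal (q (g t - φ n t))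
      ≤ ∫⁻ _ in Icc a b, ENNReal.ofReal c :=
        setLIntegral_mono' measurableSet_Icc fun t ht => ENNReal.ofReal_le_ofReal (hN n hn t ht)
    _ = ENNReal.ofReal c * volume (Icc a b) := by simp
    _ ≤ ε := hc

end Uniform

end WeakIntegral

/-! ### Separated sequences of positive lower density -/

theorem sum_padicValNat_two_le (n : ℕ) : ∑ i ∈ Finset.range n, padicValNat 2 (i + 1) ≤ n := by
  have h : ∑ i ∈ Finset.range n, padicValNat 2 (i + 1) = padicValNat 2 n.factorial := by
    induction n with
    | zero => simp
    | succ n ih =>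
      rw [Finset.sum_range_succ, ih, Nat.factorial_succ,
        padicValNat.mul (Nat.succ_ne_zero n) (Nat.factorial_ne_zero n), add_comm]
  have h2 := sub_one_mul_padicValNat_factorial (p := 2) n
  omega

theorem padicValNat_two_pow_mul_odd (c i : ℕ) : padicValNat 2 (2 ^ c * (2 * i + 1)) = c := by
  rw [padicValNat.mul (by positivity) (by omega), padicValNat.prime_pow,
    padicValNat.eq_zero_of_not_dvd (by omega), add_zero]

/-- Every index `j` receives a position `b j` and a label `lab j` such that positions with labels
`l` and `m` are at least `M l + M m` apart, while the positions with any given label still have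
positive lower density. The label of `j` depends on the exponent of `2` in `j + 1` and grows so
slowly that the gaps have bounded averages. -/
theorem exists_separated_positions (M : ℕ → ℕ) :
    ∃ b lab : ℕ → ℕ, (∀ i j, i < j → b i + M (lab i) + M (lab j) ≤ b j) ∧
      (∀ j, M (lab j) ≤ b j) ∧
      ∀ l, ∃ (h : ℕ → ℕ) (q : ℕ), StrictMono h ∧ ∀ i, lab (h i) = l ∧ b (h i) ≤ q * (i + 1) := by
  classical
  set M' : ℕ → ℕ := fun r => ∑ i ∈ Finset.range (r + 1), (M i + 1) with hM'
  have hmono : StrictMono M' := strictMono_nat_of_lt_succ fun r => by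
    simp only [hM']
    rw [Finset.sum_range_succ _ (r + 1)]
    omega
  have hle : ∀ r, M r ≤ M' r := fun r => by
    simp only [hM']
    rw [Finset.sum_range_succ]
    omega
  set labc : ℕ → ℕ := fun c => Nat.findGreatest (fun l => M' l ≤ c) c with hlabc
  have hlab_le : ∀ c, M' (labc c) ≤ c + M' 0 := fun c => by
    by_cases h0 : labc c = 0
    · rw [h0]; omega
    · exact (Nat.findGreatest_of_ne_zero rfl h0).trans (Nat.le_add_right _ _)
  have hlab_surj : ∀ l, labc (M' l) = l := fun l =>
    (Nat.findGreatest_eq_iff).2 ⟨hmono.id_le l, fun _ => le_rfl, fun n hn _ =>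
      not_le.2 (hmono hn)⟩
  set g : ℕ → ℕ := fun j => padicValNat 2 (j + 1) + M' 0 with hg
  have hsum : ∀ n, ∑ i ∈ Finset.range n, 2 * g i ≤ 2 * (1 + M' 0) * n := fun n => by
    have h1 := sum_padicValNat_two_le n
    simp only [hg]
    rw [← Finset.mul_sum, Finset.sum_add_distrib]
    simp only [Finset.sum_const, Finset.card_range, smul_eq_mul]
    nlinarith
  set lab : ℕ → ℕ := fun j => labc (padicValNat 2 (j + 1)) with hlab
  have hMg : ∀ j, M (lab j) ≤ g j := fun j => (hle _).trans (hlab_le _)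
  refine ⟨fun j => ∑ i ∈ Finset.range j, 2 * g i + g j, lab, fun i j hij => ?_, fun j => ?_,
    fun l => ?_⟩
  · have h1 : ∑ k ∈ Finset.range (i + 1), 2 * g k ≤ ∑ k ∈ Finset.range j, 2 * g k :=
      Finset.sum_le_sum_of_subset (Finset.range_mono hij)
    rw [Finset.sum_range_succ] at h1
    have := hMg i
    have := hMg j
    simp only
    omega
  · exact (hMg j).trans (Nat.le_add_left _ _)
  · have hpos : ∀ i, 1 ≤ 2 ^ M' l * (2 * i + 1) := fun i => Nat.succ_le_of_lt (by positivity)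
    refine ⟨fun i => 2 ^ M' l * (2 * i + 1) - 1, 2 * (1 + M' 0) * (2 ^ M' l * 2),
      strictMono_nat_of_lt_succ fun i => ?_, fun i => ⟨?_, ?_⟩⟩
    · have h1 := hpos i
      have h2 : 2 ^ M' l * (2 * i + 1) < 2 ^ M' l * (2 * (i + 1) + 1) := by gcongr; omega
      omega
    · simp only [hlab]
      rw [Nat.sub_add_cancel (hpos i), padicValNat_two_pow_mul_odd, hlab_surj]
    · set j := 2 ^ M' l * (2 * i + 1) - 1 with hj
      have h1 : j + 1 = 2 ^ M' l * (2 * i + 1) := Nat.sub_add_cancel (hpos i)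
      have h2 := hsum (j + 1)
      rw [Finset.sum_range_succ] at h2
      have h3 : 2 ^ M' l * (2 * i + 1) ≤ 2 ^ M' l * 2 * (i + 1) := by
        rw [mul_assoc]; gcongr; omega
      calc ∑ i ∈ Finset.range j, 2 * g i + g j ≤ 2 * (1 + M' 0) * (j + 1) := by omega
        _ ≤ 2 * (1 + M' 0) * (2 ^ M' l * 2 * (i + 1)) := by rw [h1]; gcongr
        _ = _ := by ring

/-! ### A frequent hypercyclicity criterion along a sequence of exponents -/

section Criterion

variable {𝕜 : Type*} [RCLike 𝕜] {E : Type*} [AddCommGroup E] [Module 𝕜 E]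

theorem UnconditionallyConvergentUniformly.eventually [TopologicalSpace E] {ι : Type*} {J : Set ι}
    {x : ℕ → ι → E} (h : UnconditionallyConvergentUniformly J x) {U : Set E} (hU : U ∈ 𝓝 0) :
    ∀ᶠ N in atTop, ∀ F : Finset ℕ, (∀ n ∈ F, N ≤ n) → ∀ k ∈ J, ∑ n ∈ F, x n k ∈ U := by
  obtain ⟨N, -, hN⟩ := h U hU
  filter_upwards [eventually_ge_atTop N] with N' hN' F hF
  exact hN F fun n hn => hN'.trans (hF n hn)

/-- A sum of terms `W (lab j) (pos j)` is grouped by labels: labels `m ≤ l` contribute at most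
`4⁻ˡ` each and labels `m > l` at most `4⁻ᵐ`, hence always at most `2⁻ˡ * 2⁻ᵐ`. -/
theorem seminorm_sum_le_of_labels {p : ℕ → Seminorm 𝕜 E} (hp : Monotone p) {N : ℕ → ℕ}
    {W : ℕ → ℕ → E}
    (hN : ∀ r, ∀ m ≤ r, ∀ F : Finset ℕ, (∀ n ∈ F, N r ≤ n) → p r (∑ n ∈ F, W m n) ≤ (1 / 4) ^ r)
    {l : ℕ} {J : Finset ℕ} {lab pos : ℕ → ℕ} (hinj : InjOn pos J)
    (hl : ∀ j ∈ J, N l ≤ pos j) (hlab : ∀ j ∈ J, N (lab j) ≤ pos j) :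
    p l (∑ j ∈ J, W (lab j) (pos j)) ≤ 2 * (1 / 2) ^ l := by
  classical
  have hq : ∀ m, (1 / 4 : ℝ) ^ m = (1 / 2) ^ m * (1 / 2) ^ m := fun m => by
    rw [← mul_pow]; norm_num
  have hterm : ∀ m, p l (∑ j ∈ J with lab j = m, W (lab j) (pos j)) ≤
      (1 / 2) ^ l * (1 / 2) ^ m := fun m => by
    have hinj' : InjOn pos (J.filter fun j => lab j = m) :=
      hinj.mono (by intro j hj; simp at hj; exact hj.1)
    have e : ∑ j ∈ J with lab j = m, W (lab j) (pos j) =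
        ∑ n ∈ (J.filter fun j => lab j = m).image pos, W m n := by
      rw [Finset.sum_image hinj']
      exact Finset.sum_congr rfl fun j hj => by rw [(Finset.mem_filter.1 hj).2]
    rw [e]
    rcases le_total m l with hm | hm
    · refine (hN l m hm _ fun n hn => ?_).trans ?_
      · obtain ⟨j, hj, rfl⟩ := Finset.mem_image.1 hn
        exact hl j (Finset.mem_filter.1 hj).1
      · rw [hq]
        gcongr _ * ?_
        exact pow_le_pow_of_le_one (by norm_num) (by norm_num) hm
    · refine (hp hm _).trans ((hN m m le_rfl _ fun n hn => ?_).trans ?_)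
      · obtain ⟨j, hj, rfl⟩ := Finset.mem_image.1 hn
        obtain ⟨hjJ, rfl⟩ := Finset.mem_filter.1 hj
        exact hlab j hjJ
      · rw [hq]
        gcongr ?_ * _
        exact pow_le_pow_of_le_one (by norm_num) (by norm_num) hm
  rw [← Finset.sum_fiberwise_of_maps_to (fun j hj => Finset.mem_image_of_mem lab hj)]
  calc p l (∑ m ∈ J.image lab, ∑ j ∈ J with lab j = m, W (lab j) (pos j))
      ≤ ∑ m ∈ J.image lab, p l (∑ j ∈ J with lab j = m, W (lab j) (pos j)) :=
        Finset.le_sum_of_subadditive (p l) (map_zero (p l)).le (map_add_le_add _) _ _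
    _ ≤ ∑ m ∈ J.image lab, (1 / 2) ^ l * (1 / 2) ^ m := Finset.sum_le_sum fun m _ => hterm m
    _ = (1 / 2) ^ l * ∑ m ∈ J.image lab, (1 / 2 : ℝ) ^ m := by rw [Finset.mul_sum]
    _ ≤ (1 / 2) ^ l * 2 := by
        gcongr
        exact (summable_geometric_two.sum_le_tsum _ fun m _ => by positivity).trans_eq
          tsum_geometric_two
    _ = _ := mul_comm _ _

theorem exists_seminorm_ball_subset [TopologicalSpace E] {p : ℕ → Seminorm 𝕜 E}
    (hp : WithSeminorms p) (hmono : Monotone p) {U : Set E} {x : E} (hU : U ∈ 𝓝 x) :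
    ∃ r, ∃ ε > 0, ∀ y, p r (y - x) < ε → y ∈ U := by
  obtain ⟨s, ε, hε, hs⟩ := (hp.mem_nhds_iff x U).1 hU
  refine ⟨s.sup id, ε, hε, fun y hy => hs ?_⟩
  rw [Seminorm.mem_ball]
  refine lt_of_le_of_lt ?_ hy
  have : s.sup p ≤ p (s.sup id) := Finset.sup_le fun i hi => hmono (Finset.le_sup (f := id) hi)
  exact this _

/-- A frequent hypercyclicity criterion for `L` along the exponents `a k`. The vectors `v l k`
play the role of preimages of `y l` under `L ^ a k`; the vector that is constructed is
`∑ j, v (lab j) (b j)` for well separated positions `b j`. -/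
theorem exists_frequently_hypercyclic_vector [UniformSpace E] [IsUniformAddGroup E]
    [CompleteSpace E] {p : ℕ → Seminorm 𝕜 E} (hp : WithSeminorms p) (hmono : Monotone p)
    (L : E →L[𝕜] E) {a : ℕ → ℕ} (ha : Monotone a) {y : ℕ → E} {v : ℕ → ℕ → E} {k₀ : ℕ}
    (hk₀ : 1 ≤ k₀)
    (hy : ∀ V : Set E, IsOpen V → V.Nonempty → ∃ c ∈ V, ∃ᶠ l in atTop, y l = c)
    (hv : ∀ l, ∀ k ≥ k₀, (L ^ a k) (v l k) = y l)
    (hconv : ∀ l, UnconditionallyConvergentUniformly univ fun n (_ : Unit) => v l n)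
    (hfwd : ∀ l, UnconditionallyConvergentUniformly {k : ℕ | 1 ≤ k}
      fun n k => (L ^ a k) (v l (k + n)))
    (hbwd : ∀ l, UnconditionallyConvergentUniformly {k : ℕ | 1 ≤ k}
      fun n k => if n ≤ k then (L ^ (a k - a (k - n))) (y l) else 0)
    (hgrowth : ∀ k ≥ 1, a k < a (k + k₀)) :
    ∃ x : E, ∀ V : Set E, IsOpen V → V.Nonempty → ∃ (q : ℕ) (g : ℕ → ℕ),
      StrictMono (fun i => a (g i)) ∧ ∀ i, 1 ≤ g i ∧ g i ≤ q * (i + 1) ∧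
        (L ^ a (g i)) x ∈ V := by
  classical
  have hU : ∀ r, {z : E | p r z < (1 / 4) ^ r} ∈ 𝓝 (0 : E) := fun r =>
    ((hp.continuous_seminorm r).tendsto' 0 0 (map_zero _)).eventually
      (gt_mem_nhds (by positivity))
  have hex : ∀ r : ℕ, ∃ N ≥ k₀, ∀ m ∈ Finset.range (r + 1), ∀ F : Finset ℕ, (∀ n ∈ F, N ≤ n) →
      p r (∑ n ∈ F, v m n) < (1 / 4) ^ r ∧ ∀ k ≥ 1,
        p r (∑ n ∈ F, (L ^ a k) (v m (k + n))) < (1 / 4) ^ r ∧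
        p r (∑ n ∈ F, if n ≤ k then (L ^ (a k - a (k - n))) (y m) else 0) < (1 / 4) ^ r := by
    intro r
    have h1 : ∀ᶠ N in atTop, ∀ m ∈ Finset.range (r + 1), ∀ F : Finset ℕ, (∀ n ∈ F, N ≤ n) →
        p r (∑ n ∈ F, v m n) < (1 / 4) ^ r ∧ ∀ k ≥ 1,
          p r (∑ n ∈ F, (L ^ a k) (v m (k + n))) < (1 / 4) ^ r ∧
          p r (∑ n ∈ F, if n ≤ k then (L ^ (a k - a (k - n))) (y m) else 0) < (1 / 4) ^ r := by
      rw [Filter.eventually_all_finset]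
      intro m _
      filter_upwards [(hconv m).eventually (hU r), (hfwd m).eventually (hU r),
        (hbwd m).eventually (hU r)] with N h1 h2 h3 F hF
      exact ⟨h1 F hF () (mem_univ _), fun k hk => ⟨h2 F hF k hk, h3 F hF k hk⟩⟩
    exact ((eventually_ge_atTop k₀).and h1).exists
  choose N hNk hN using hex
  obtain ⟨b, lab, hsep, hb, hdens⟩ := exists_separated_positions N
  have hN1 : ∀ r, 1 ≤ N r := fun r => hk₀.trans (hNk r)
  have hbmono : StrictMono b := fun i j hij => by
    have := hsep i j hij
    have := hN1 (lab i)
    omega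
  have hb1 : ∀ j, k₀ ≤ b j := fun j => (hNk _).trans (hb j)
  have hsum : Summable fun j => v (lab j) (b j) := by
    rw [summable_iff_vanishing]
    intro U hU0
    obtain ⟨r, ε, hε, hr⟩ := exists_seminorm_ball_subset hp hmono hU0
    obtain ⟨d, hd⟩ := exists_pow_lt_of_lt_one (half_pos hε) (show (1 / 2 : ℝ) < 1 by norm_num)
    set l := max r d
    refine ⟨Finset.range (N l), fun t ht => hr _ ?_⟩
    rw [sub_zero]
    have h1 : p l (∑ j ∈ t, v (lab j) (b j)) ≤ 2 * (1 / 2) ^ l := by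
      refine seminorm_sum_le_of_labels hmono (N := N)
        (fun s m hm F hF => (hN s m (by simp; omega) F hF).1.le) hbmono.injective.injOn
        (fun j hj => ?_) fun j _ => hb j
      have : j ∉ Finset.range (N l) := Finset.disjoint_left.1 ht hj
      simp only [Finset.mem_range, not_lt] at this
      exact this.trans (hbmono.id_le j)
    have h2 : (1 / 2 : ℝ) ^ l ≤ (1 / 2) ^ d :=
      pow_le_pow_of_le_one (by norm_num) (by norm_num) (le_max_right _ _)
    have h3 := hmono (le_max_left r d) (∑ j ∈ t, v (lab j) (b j))
    have h4 : p r (∑ j ∈ t, v (lab j) (b j)) ≤ p l (∑ j ∈ t, v (lab j) (b j)) := h3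
    linarith
  obtain ⟨x, hx⟩ := hsum
  have herr : ∀ i, p (lab i) ((L ^ a (b i)) x - y (lab i)) ≤ 4 * (1 / 2) ^ lab i := by
    intro i
    set l := lab i with hl
    have hx' : HasSum (fun j => (L ^ a (b i)) (v (lab j) (b j))) ((L ^ a (b i)) x) :=
      hx.mapL (L ^ a (b i))
    have hlim : Tendsto (fun J : Finset ℕ =>
        p l (∑ j ∈ J, (L ^ a (b i)) (v (lab j) (b j)) - y l)) atTop
        (𝓝 (p l ((L ^ a (b i)) x - y l))) :=
      ((hp.continuous_seminorm l).tendsto _).comp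
        (Tendsto.sub_const hx' (y l))
    refine le_of_tendsto hlim ?_
    filter_upwards [eventually_ge_atTop ({i} : Finset ℕ)] with J hJ
    have hiJ : i ∈ J := hJ (Finset.mem_singleton_self i)
    have hbi : 1 ≤ b i := hk₀.trans (hb1 i)
    -- The term `j = i` is `y l`; the terms `j < i` and `j > i` form the two error sums.
    have hsplit : ∑ j ∈ J, (L ^ a (b i)) (v (lab j) (b j)) - y l =
        (∑ j ∈ J with j < i, (L ^ a (b i)) (v (lab j) (b j))) +
        ∑ j ∈ J with i < j, (L ^ a (b i)) (v (lab j) (b j)) := by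
      rw [← Finset.add_sum_erase J _ hiJ, hv _ _ (hb1 i), add_sub_cancel_left,
        ← Finset.sum_filter_add_sum_filter_not (J.erase i) (fun j => j < i)]
      congr 1
      · refine Finset.sum_congr ?_ fun _ _ => rfl
        ext j; simp only [Finset.mem_filter, Finset.mem_erase]; grind
      · refine Finset.sum_congr ?_ fun _ _ => rfl
        ext j; simp only [Finset.mem_filter, Finset.mem_erase]; grind
    have hlow : p l (∑ j ∈ J with j < i, (L ^ a (b i)) (v (lab j) (b j))) ≤
        2 * (1 / 2) ^ l := by
      have e : ∑ j ∈ J with j < i, (L ^ a (b i)) (v (lab j) (b j)) =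
          ∑ j ∈ J with j < i, (fun m n => if n ≤ b i then
            (L ^ (a (b i) - a (b i - n))) (y m) else 0) (lab j) (b i - b j) := by
        refine Finset.sum_congr rfl fun j hj => ?_
        have hji := hbmono (Finset.mem_filter.1 hj).2
        have h2 : a (b j) ≤ a (b i) := ha hji.le
        simp only [Nat.sub_le, if_true, Nat.sub_sub_self hji.le]
        rw [← hv (lab j) (b j) (hb1 j), ← mul_apply_eq_comp, ← pow_add, Nat.sub_add_cancel h2]
      rw [e]
      refine seminorm_sum_le_of_labels hmono (N := N)
        (fun s m hm F hF => ((hN s m (by simp; omega) F hF).2 (b i) hbi).2.le) ?_ ?_ ?_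
      · intro j hj j' hj' hjj
        simp only [Finset.coe_filter, mem_ofPred_eq] at hj hj'
        have h1 := hbmono hj.2
        have h2 := hbmono hj'.2
        simp only at hjj
        exact hbmono.injective (by omega)
      · intro j hj
        have := hsep j i (Finset.mem_filter.1 hj).2
        rw [← hl] at this
        omega
      · intro j hj
        have := hsep j i (Finset.mem_filter.1 hj).2
        rw [← hl] at this
        omega
    have hhigh : p l (∑ j ∈ J with i < j, (L ^ a (b i)) (v (lab j) (b j))) ≤
        2 * (1 / 2) ^ l := by
      have e : ∑ j ∈ J with i < j, (L ^ a (b i)) (v (lab j) (b j)) =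
          ∑ j ∈ J with i < j, (fun m n => (L ^ a (b i)) (v m (b i + n))) (lab j)
            (b j - b i) := by
        refine Finset.sum_congr rfl fun j hj => ?_
        have hji := hbmono (Finset.mem_filter.1 hj).2
        simp only [Nat.add_sub_cancel' hji.le]
      rw [e]
      refine seminorm_sum_le_of_labels hmono (N := N)
        (fun s m hm F hF => ((hN s m (by simp; omega) F hF).2 (b i) hbi).1.le) ?_ ?_ ?_
      · intro j hj j' hj' hjj
        simp only [Finset.coe_filter, mem_ofPred_eq] at hj hj'
        have h1 := hbmono hj.2
        have h2 := hbmono hj'.2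
        simp only at hjj
        exact hbmono.injective (by omega)
      · intro j hj
        have := hsep i j (Finset.mem_filter.1 hj).2
        rw [← hl] at this
        omega
      · intro j hj
        have := hsep i j (Finset.mem_filter.1 hj).2
        rw [← hl] at this
        omega
    rw [hsplit]
    refine (map_add_le_add (p l) _ _).trans ?_
    linarith
  refine ⟨x, fun V hV hVne => ?_⟩
  obtain ⟨c, hcV, hc⟩ := hy V hV hVne
  obtain ⟨r, ε, hε, hr⟩ := exists_seminorm_ball_subset hp hmono (hV.mem_nhds hcV)
  obtain ⟨d, hd⟩ := exists_pow_lt_of_lt_one (show 0 < ε / 4 by positivity)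
    (show (1 / 2 : ℝ) < 1 by norm_num)
  obtain ⟨l, hyl, hl⟩ := (hc.and_eventually (eventually_ge_atTop (max r d))).exists
  obtain ⟨h, q, hh, hq⟩ := hdens l
  refine ⟨q, fun i => b (h i), strictMono_nat_of_lt_succ fun i => ?_, fun i =>
    ⟨hk₀.trans (hb1 _), (hq i).2, hr _ ?_⟩⟩
  · have h1 := hsep _ _ (hh (show i < i + 1 by omega))
    have h2 := hNk (lab (h i))
    exact (hgrowth _ (hk₀.trans (hb1 (h i)))).trans_le (ha (by simp only; omega))
  · have h1 := herr (h i)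
    rw [(hq i).1, hyl] at h1
    have h2 : p r ((L ^ a (b (h i))) x - c) ≤ p l ((L ^ a (b (h i))) x - c) :=
      hmono ((le_max_left r d).trans hl) _
    have h3 : (1 / 2 : ℝ) ^ l ≤ (1 / 2) ^ d :=
      pow_le_pow_of_le_one (by norm_num) (by norm_num) ((le_max_right _ _).trans hl)
    linarith

end Criterion

/-! ### Averages of a semigroup along a ray -/

section Ray

variable {𝕜 : Type*} [RCLike 𝕜] {E : Type*} [AddCommGroup E] [Module 𝕜 E]

theorem eq_of_forall_dual_eq [TopologicalSpace E] [PolynormableSpace 𝕜 E] [T1Space E] {x y : E}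
    (h : ∀ u : StrongDual 𝕜 E, u x = u y) : x = y :=
  HasWeakIntegral.unique (𝕜 := 𝕜) (A := Icc 0 1) (g := fun _ => x)
    (fun u => ⟨integrableOn_const (by simp), by simp⟩)
    (fun u => ⟨integrableOn_const (by simp), by simp [h]⟩)

/-- A strongly continuous family of operators indexed by a compact set is equicontinuous, by the
Banach–Steinhaus theorem. -/
theorem exists_seminorm_bound_of_isCompact [UniformSpace E] [IsUniformAddGroup E]
    [PolynormableSpace 𝕜 E] [FirstCountableTopology E] [CompleteSpace E] [ContinuousSMul 𝕜 E]
    {X : Type*} [TopologicalSpace X] {K : Set X}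
    (hK : IsCompact K) {T : X → E →L[𝕜] E} (hT : ∀ x, ContinuousOn (fun t => T t x) K)
    {q : Seminorm 𝕜 E} (hq : Continuous q) :
    ∃ r : Seminorm 𝕜 E, Continuous r ∧ ∀ t ∈ K, ∀ x, q (T t x) ≤ r x := by
  have hcg : (uniformity E).IsCountablyGenerated :=
    IsUniformAddGroup.uniformity_countably_generated
  have hw := PolynormableSpace.withSeminorms 𝕜 E
  have hequi : UniformEquicontinuous (DFunLike.coe ∘ fun t : K => T t) :=
    hw.banach_steinhaus (𝓕 := fun t : K => T t) fun k x => by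
      have := (hK.image_of_continuousOn (k.2.comp_continuousOn (hT x))).bddAbove
      refine this.mono ?_
      rintro _ ⟨t, rfl⟩
      exact ⟨t, t.2, rfl⟩
  obtain ⟨r, hr, hle⟩ := (hw.uniformEquicontinuous_iff_exists_continuous_seminorm
    (fun t : K => (T t : E →ₗ[𝕜] E))).1 hequi ⟨q, hq⟩
  exact ⟨r, hr, fun t ht x => hle ⟨t, ht⟩ x⟩

/-- A strongly continuous one-parameter semigroup of operators, indexed by `t ≥ 0`; its values at
negative arguments are irrelevant. -/
structure IsRaySemigroup [TopologicalSpace E] (R : ℝ → E →L[𝕜] E) : Prop where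
  map_zero : R 0 = ContinuousLinearMap.id 𝕜 E
  map_add : ∀ t, 0 ≤ t → ∀ s, 0 ≤ s → R (t + s) = (R t).comp (R s)
  continuousOn : ∀ x : E, ContinuousOn (fun t => R t x) (Ici 0)

namespace IsRaySemigroup

section

variable [TopologicalSpace E] {R : ℝ → E →L[𝕜] E}

theorem add_apply (hR : IsRaySemigroup R) {t s : ℝ} (ht : 0 ≤ t) (hs : 0 ≤ s) (x : E) :
    R (t + s) x = R t (R s x) := by
  rw [hR.map_add t ht s hs]; rfl

theorem comp_mul_left (hR : IsRaySemigroup R) {c : ℝ} (hc : 0 ≤ c) :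
    IsRaySemigroup fun t => R (c * t) where
  map_zero := by simpa using hR.map_zero
  map_add t ht s hs := by
    rw [mul_add]; exact hR.map_add _ (mul_nonneg hc ht) _ (mul_nonneg hc hs)
  continuousOn x := (hR.continuousOn x).comp (by fun_prop) fun t ht => mul_nonneg hc ht

theorem pow_one_eq (hR : IsRaySemigroup R) (n : ℕ) : R 1 ^ n = R n := by
  induction n with
  | zero => rw [pow_zero, Nat.cast_zero, hR.map_zero]; rfl
  | succ n ih =>
    rw [pow_succ, ih, Nat.cast_succ, hR.map_add n n.cast_nonneg 1 zero_le_one]; rfl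

/-- Translating the averaging interval `[0, 1]` by `D` amounts to applying `R D`. -/
theorem hasWeakIntegral_translate (hR : IsRaySemigroup R) {x y : E}
    (h : HasWeakIntegral 𝕜 (Icc 0 1) (fun t => R t x) y) {D : ℝ} (hD : 0 ≤ D) :
    HasWeakIntegral 𝕜 (Icc D (D + 1)) (fun t => R t x) (R D y) := by
  have h1 := (h.map (R D)).comp_sub_right D
  rw [zero_add, add_comm 1 D] at h1
  refine h1.congr_Ioc fun t ht => ?_
  rw [← hR.add_apply hD (sub_nonneg.2 ht.1.le), add_sub_cancel]

/-- The average over `[0, 1]` splits into the averages of the semigroup run at half speed. -/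
theorem two_smul_average (hR : IsRaySemigroup R) [PolynormableSpace 𝕜 E] [T1Space E] {x y y' : E}
    (h : HasWeakIntegral 𝕜 (Icc 0 1) (fun t => R t x) y)
    (h' : HasWeakIntegral 𝕜 (Icc 0 1) (fun t => R (1 / 2 * t) x) y') :
    (2 : 𝕜) • y = y' + R (1 / 2) y' := by
  refine eq_of_forall_dual_eq (𝕜 := 𝕜) fun u => ?_
  have hR' := hR.comp_mul_left (c := 1 / 2) (by norm_num)
  have h1 := (h u)
  have h2 := (h' u).2
  have h3 := ((hR'.hasWeakIntegral_translate h' zero_le_one) u).2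
  have hi := h1.1
  rw [integrableOn_Icc_iff_integrableOn_Ioc,
    ← intervalIntegrable_iff_integrableOn_Ioc_of_le zero_le_one] at hi
  have h1 := h1.2
  rw [integral_Icc_eq_integral_Ioc, ← intervalIntegral.integral_of_le (by norm_num)] at h1 h2 h3
  rw [intervalIntegral.integral_comp_mul_left (fun t => u (R t x)) (by norm_num)] at h2 h3
  have hsub : ∀ a b : ℝ, 0 ≤ a → a ≤ b → b ≤ 1 →
      IntervalIntegrable (fun t => u (R t x)) volume a b := fun a b ha hab hb =>
    hi.mono_set (by rw [uIcc_of_le hab, uIcc_of_le zero_le_one]; exact Icc_subset_Icc ha hb)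
  have hadd := intervalIntegral.integral_add_adjacent_intervals
    (hsub 0 (1 / 2) le_rfl (by norm_num) (by norm_num))
    (hsub (1 / 2) 1 (by norm_num) (by norm_num) le_rfl)
  simp only [_root_.map_add, map_smul, smul_eq_mul]
  norm_num at h2 h3
  rw [one_div] at *
  rw [← h1, ← h2, ← h3, ← hadd]
  simp only [Algebra.smul_def, map_ofNat]
  ring

/-- If the orbit of `Q' x` under the semigroup `R'` at half speed comes arbitrarily close to `0`,
then `Q' x` belongs to the closure of the range of `Q`, because
`Q' x - (-R' 1) ^ d (Q' x)` is divisible by `1 + R' 1` and `(1 + R' 1) Q' = 2 Q`. -/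
theorem half_average_mem_closure_range [IsTopologicalAddGroup E]
    [PolynormableSpace 𝕜 E] [T1Space E] (hR : IsRaySemigroup R) {Q Q' : E →L[𝕜] E}
    (hQ : ∀ x, HasWeakIntegral 𝕜 (Icc 0 1) (fun t => R t x) (Q x))
    (hQ' : ∀ x, HasWeakIntegral 𝕜 (Icc 0 1) (fun t => R (1 / 2 * t) x) (Q' x)) {x : E}
    (hsmall : ∀ U ∈ 𝓝 (0 : E), ∃ d : ℕ, R (1 / 2 * d) (Q' x) ∈ U) :
    Q' x ∈ closure (range Q) := by
  have hcomm : ∀ t, 0 ≤ t → ∀ z, R t (Q z) = Q (R t z) := fun t ht z =>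
    ((hQ z).map (R t)).unique ((hQ (R t z)).congr_Ioc fun s hs => by
      rw [← hR.add_apply hs.1.le ht, ← hR.add_apply ht hs.1.le, add_comm])
  have hstep : ∀ d : ℕ, ∃ ε : 𝕜, ‖ε‖ = 1 ∧ ∃ z, Q' x - ε • R (1 / 2 * d) (Q' x) = Q z := by
    intro d
    induction d with
    | zero => exact ⟨1, norm_one, 0, by simp [hR.map_zero]⟩
    | succ d ih =>
      obtain ⟨ε, hε, z, hz⟩ := ih
      refine ⟨-ε, by rwa [norm_neg], (2 : 𝕜) • x - R (1 / 2) z, ?_⟩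
      have h2 := hR.two_smul_average (hQ x) (hQ' x)
      have h3 : R (1 / 2 * (d + 1 : ℕ)) (Q' x) = R (1 / 2) (R (1 / 2 * d) (Q' x)) := by
        rw [← hR.add_apply (by norm_num) (by positivity)]
        congr 2
        push_cast
        ring
      rw [map_sub, map_smul, h2, ← hcomm _ (by norm_num), ← hz, h3, map_sub, map_smul, neg_smul]
      abel
  have hw := PolynormableSpace.withSeminorms 𝕜 E
  rw [mem_closure_iff_nhds]
  intro U hU
  obtain ⟨s, r, hr, hsub⟩ := (hw.mem_nhds_iff (Q' x) U).1 hU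
  set q : Seminorm 𝕜 E := s.sup fun p : {p : Seminorm 𝕜 E // Continuous p} => p.1
  have hqc : Continuous q := Seminorm.continuous_finsetSup fun p _ => p.2
  obtain ⟨d, hd⟩ := hsmall {z | q z < r}
    ((hqc.tendsto' 0 0 (_root_.map_zero q)).eventually (gt_mem_nhds hr))
  obtain ⟨ε, hε, z, hz⟩ := hstep d
  refine ⟨Q z, hsub ?_, mem_range_self z⟩
  rw [Seminorm.mem_ball, ← hz, sub_sub_cancel_left, map_neg_eq_map, map_smul_eq_mul, hε, one_mul]
  exact hd

end

section Uniform

variable [UniformSpace E] [IsUniformAddGroup E] [PolynormableSpace 𝕜 E]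
  [FirstCountableTopology E] [CompleteSpace E]

theorem bochnerIntegrableOn {R : ℝ → E →L[𝕜] E} (hR : IsRaySemigroup R) {a b : ℝ} (ha : 0 ≤ a)
    (x : E) :
    BochnerIntegrableOn 𝕜 (Icc a b) fun t => R t x :=
  bochnerIntegrableOn_Icc ((hR.continuousOn x).mono fun _ ht => ha.trans ht.1)

variable [ContinuousSMul 𝕜 E] [T2Space E] {R : ℝ → E →L[𝕜] E}

theorem exists_average (hR : IsRaySemigroup R) :
    ∃ Q : E →L[𝕜] E, ∀ x, HasWeakIntegral 𝕜 (Icc 0 1) (fun t => R t x) (Q x) := by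
  have h := fun x => (hR.bochnerIntegrableOn (a := 0) (b := 1) le_rfl x).hasWeakIntegral
  let Q : E →ₗ[𝕜] E :=
    { toFun := fun x => bochnerIntegral 𝕜 (Icc 0 1) fun t => R t x
      map_add' := fun x y => (h (x + y)).unique (by simpa only [_root_.map_add] using (h x).add (h y))
      map_smul' := fun c x => (h (c • x)).unique (by
        simpa only [map_smul, RingHom.id_apply] using (h x).const_smul c) }
  refine ⟨⟨Q, ?_⟩, h⟩
  refine (PolynormableSpace.withSeminorms 𝕜 E).continuous_of_continuous_comp Q fun q => ?_
  obtain ⟨r, hr, hle⟩ := exists_seminorm_bound_of_isCompact (isCompact_Icc (a := (0 : ℝ)) (b := 1))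
    (fun x => (hR.continuousOn x).mono fun _ ht => ht.1) q.2
  refine Seminorm.continuous_of_le hr fun x => ?_
  have := (h x).seminorm_le (by simp) q.2 fun t ht => hle t ht x
  rw [Real.volume_real_Icc_of_le zero_le_one, sub_zero, mul_one] at this
  exact this

/-- The averages `∫₀¹ R t x dt` are dense as soon as the orbits of the averages of the semigroups
run at the speeds `2⁻ʲ` come close to `0`: the range for the speed `2⁻ʲ` is contained in the
closure of the range for the speed `1`, and the averages for the speed `2⁻ʲ` tend to the
identity. -/
theorem denseRange_average (hR : IsRaySemigroup R) {E₀ : Set E} (hE₀ : Dense E₀)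
    (hsmall : ∀ (j : ℕ) (x : E), x ∈ E₀ → ∀ y,
      HasWeakIntegral 𝕜 (Icc 0 1) (fun t => R ((1 / 2) ^ j * t) x) y →
      ∀ U ∈ 𝓝 (0 : E), ∃ d : ℕ, R ((1 / 2) ^ j * d) y ∈ U)
    {Q : E →L[𝕜] E} (hQ : ∀ x, HasWeakIntegral 𝕜 (Icc 0 1) (fun t => R t x) (Q x)) :
    DenseRange Q := by
  have hRj : ∀ j : ℕ, IsRaySemigroup fun t => R ((1 / 2) ^ j * t) := fun j =>
    hR.comp_mul_left (by positivity)
  choose Qj hQj using fun j => (hRj j).exists_average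
  have hrange : ∀ j, range (Qj j) ⊆ closure (range Q) := by
    intro j
    induction j with
    | zero =>
      have : Qj 0 = Q := by
        ext x
        exact (hQj 0 x).unique (by simpa using hQ x)
      rw [this]
      exact subset_closure
    | succ j ih =>
      have hhalf : ∀ t : ℝ, (1 / 2 : ℝ) ^ (j + 1) * t = (1 / 2) ^ j * (1 / 2 * t) := fun t => by
        rw [pow_succ, mul_assoc]
      have h1 : Qj (j + 1) '' E₀ ⊆ closure (range (Qj j)) := by
        rintro _ ⟨x, hx, rfl⟩
        refine (hRj j).half_average_mem_closure_range (hQj j) (Q' := Qj (j + 1))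
          (fun z => by simpa only [hhalf] using hQj (j + 1) z) fun U hU => ?_
        obtain ⟨d, hd⟩ := hsmall (j + 1) x hx _ (hQj (j + 1) x) U hU
        exact ⟨d, by simpa only [hhalf] using hd⟩
      have h2 : range (Qj (j + 1)) ⊆ closure (Qj (j + 1) '' E₀) := by
        rw [← image_univ, ← hE₀.closure_eq]
        exact image_closure_subset_closure_image (Qj (j + 1)).continuous
      exact h2.trans (closure_minimal (h1.trans (closure_minimal ih isClosed_closure))
        isClosed_closure)
  intro x
  have hlim : Tendsto (fun j => Qj j x) atTop (𝓝 x) := by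
    rw [(PolynormableSpace.withSeminorms 𝕜 E).tendsto_nhds]
    intro q ε hε
    have hcont : Tendsto (fun t => q.1 (R t x - x)) (𝓝[Ici 0] 0) (𝓝 0) := by
      have h1 : Tendsto (fun t => R t x) (𝓝[Ici 0] 0) (𝓝 x) := by
        simpa [ContinuousWithinAt, hR.map_zero] using hR.continuousOn x 0 self_mem_Ici
      exact (q.2.tendsto' 0 0 (_root_.map_zero _)).comp (by simpa using h1.sub_const x)
    obtain ⟨δ, hδ, hball⟩ := Metric.mem_nhdsWithin_iff.1
      (hcont.eventually (gt_mem_nhds (half_pos hε)))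
    have hpow : Tendsto (fun j : ℕ => (1 / 2 : ℝ) ^ j) atTop (𝓝 0) :=
      tendsto_pow_atTop_nhds_zero_of_lt_one (by norm_num) (by norm_num)
    filter_upwards [hpow.eventually (gt_mem_nhds hδ)] with j hj
    have hconst : HasWeakIntegral 𝕜 (Icc (0 : ℝ) 1) (fun _ => x) x := fun u =>
      ⟨integrableOn_const (by simp), by simp⟩
    have := ((hQj j x).sub hconst).seminorm_le (by simp) q.2 (C := ε / 2) fun t ht => by
      have h0 : 0 ≤ (1 / 2 : ℝ) ^ j * t := mul_nonneg (by positivity) ht.1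
      refine le_of_lt (hball (show (1 / 2 : ℝ) ^ j * t ∈ _ from ⟨?_, h0⟩))
      rw [Metric.mem_ball, Real.dist_eq, sub_zero, abs_of_nonneg h0]
      exact (mul_le_of_le_one_right (by positivity) ht.2).trans_lt hj
    simp only [Real.volume_real_Icc, sub_zero, zero_le_one, sup_of_le_left, mul_one] at this
    linarith
  exact isClosed_closure.mem_of_tendsto hlim
    (Eventually.of_forall fun j => hrange j (mem_range_self x))

end Uniform

end IsRaySemigroup

end Ray

/-! ### Frequent hypercyclicity of the time-one operator of a ray -/

section TimeOne

variable {𝕜 : Type*} [RCLike 𝕜] {E : Type*} [AddCommGroup E] [Module 𝕜 E]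

theorem UnconditionallyConvergentUniformly.congr_of_ge [TopologicalSpace E] {ι : Type*} {J : Set ι}
    {x x' : ℕ → ι → E} (h : UnconditionallyConvergentUniformly J x) {N₀ : ℕ}
    (hx : ∀ n ≥ N₀, ∀ k ∈ J, x n k = x' n k) : UnconditionallyConvergentUniformly J x' := by
  intro U hU
  obtain ⟨N, hN1, hN⟩ := h U hU
  refine ⟨max N N₀, hN1.trans (le_max_left _ _), fun F hF k hk => ?_⟩
  rw [← Finset.sum_congr rfl fun n hn => hx n ((le_max_right _ _).trans (hF n hn)) k hk]
  exact hN F (fun n hn => (le_max_left _ _).trans (hF n hn)) k hk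

theorem UnconditionallyConvergentUniformly.comp_sub_one [TopologicalSpace E] {ι κ : Type*}
    {J : Set ι} {J' : Set κ} {x : ℕ → ι → E} (h : UnconditionallyConvergentUniformly J x) {k₁ : ι}
    (hk₁ : k₁ ∈ J) : UnconditionallyConvergentUniformly J' fun n _ => x (n - 1) k₁ := by
  classical
  intro U hU
  obtain ⟨N, hN1, hN⟩ := h U hU
  refine ⟨N + 1, by omega, fun F hF _ _ => ?_⟩
  have hinj : InjOn (fun n => n - 1) (F : Set ℕ) := fun m hm n hn hmn => by
    have := hF m hm
    have := hF n hn
    simp only at hmn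
    omega
  rw [← Finset.sum_image (f := fun n => x n k₁) hinj]
  refine hN _ (fun n hn => ?_) k₁ hk₁
  obtain ⟨m, hm, rfl⟩ := Finset.mem_image.1 hn
  have := hF m hm
  omega

/-- The convergence of the backward sums of a nonzero vector prevents `a` from being constant on
long intervals: otherwise the vector itself would occur as a term with arbitrarily large index. -/
theorem exists_forall_lt_of_unconditionallyConvergentUniformly [TopologicalSpace E] [T1Space E]
    {L : E →L[𝕜] E} {a : ℕ → ℕ} (ha : Monotone a) {y : E} (hy : y ≠ 0)
    (h : UnconditionallyConvergentUniformly {k : ℕ | 1 ≤ k}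
      fun n k => if n ≤ k then (L ^ (a k - a (k - n))) y else 0) :
    ∃ N ≥ 1, ∀ n ≥ N, ∀ k ≥ 1, a k < a (k + n) := by
  obtain ⟨N, hN1, hN⟩ := h {y}ᶜ (isOpen_compl_singleton.mem_nhds hy.symm)
  refine ⟨N, hN1, fun n hn k hk => lt_of_le_of_ne (ha (Nat.le_add_right _ _)) fun heq => ?_⟩
  have := hN {n} (by simpa using hn) (k + n) (show 1 ≤ k + n by omega)
  simp [← heq] at this

theorem lowerSeqDensity_pos_of_strictMono {f : ℝ → ℝ} {A : Set ℕ} {a g : ℕ → ℕ} {q : ℕ}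
    (hf : MonotoneOn f (Ici 0)) (ha : ∀ k, 1 ≤ a k ∧ (a k : ℝ) ≤ f k)
    (hg : StrictMono fun i => a (g i)) (hgq : ∀ i, 1 ≤ g i ∧ g i ≤ q * (i + 1))
    (hA : ∀ i, a (g i) ∈ A) : 0 < lowerSeqDensity (fun k : ℕ => f k) A := by
  have hq : 1 ≤ q := by
    have := hgq 0
    omega
  have hkey : ∀ n ≥ q, (n : ℝ≥0∞) / (2 * q) ≤
      (({j ∈ A | 1 ≤ j ∧ (j : ℝ) ≤ f n}.ncard : ℕ) : ℝ≥0∞) := by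
    intro n hn
    have hfin : {j ∈ A | 1 ≤ j ∧ (j : ℝ) ≤ f n}.Finite :=
      (Set.finite_Iic ⌊f n⌋₊).subset fun j hj => Nat.le_floor hj.2.2
    have hsub : ((Finset.range (n / q)).image fun i => a (g i) : Set ℕ) ⊆
        {j ∈ A | 1 ≤ j ∧ (j : ℝ) ≤ f n} := by
      intro j hj
      obtain ⟨i, hi, rfl⟩ := Finset.mem_image.1 (Finset.mem_coe.1 hj)
      have hi := Finset.mem_range.1 hi
      refine ⟨hA i, (ha _).1, (ha _).2.trans (hf (mem_Ici.2 (Nat.cast_nonneg _))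
        (mem_Ici.2 (Nat.cast_nonneg _)) ?_)⟩
      have h1 : q * (i + 1) ≤ q * (n / q) := Nat.mul_le_mul_left q hi
      have h2 := Nat.mul_div_le n q
      exact_mod_cast (hgq i).2.trans (h1.trans h2)
    have hcard : n / q ≤ {j ∈ A | 1 ≤ j ∧ (j : ℝ) ≤ f n}.ncard := by
      have h1 := Set.ncard_le_ncard hsub hfin
      rwa [Set.ncard_coe_finset, Finset.card_image_of_injective _ hg.injective,
        Finset.card_range] at h1
    have h2 : n ≤ n / q * (2 * q) := by
      have h3 := Nat.div_add_mod n q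
      have h4 := Nat.mod_lt n hq
      have h5 : 1 ≤ n / q := Nat.div_pos hn hq
      nlinarith
    refine ENNReal.div_le_of_le_mul ?_
    calc (n : ℝ≥0∞) ≤ ((n / q * (2 * q) : ℕ) : ℝ≥0∞) := by exact_mod_cast h2
      _ = ((n / q : ℕ) : ℝ≥0∞) * (2 * q) := by push_cast; ring
      _ ≤ _ := by gcongr
  have hpos : (0 : ℝ≥0∞) < (2 * (q : ℝ≥0∞))⁻¹ :=
    ENNReal.inv_pos.2 (ENNReal.mul_ne_top ENNReal.ofNat_ne_top (ENNReal.natCast_ne_top q))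
  refine hpos.trans_le (le_liminf_of_le (by isBoundedDefault) ?_)
  filter_upwards [eventually_ge_atTop q] with n hn
  rw [ENNReal.le_div_iff_mul_le (Or.inl (by norm_cast; omega)) (Or.inl (ENNReal.natCast_ne_top n)),
    mul_comm]
  exact hkey n hn

theorem natFloor_spec {f : ℝ → ℝ} (hf : MonotoneOn f (Ici 0)) (hf1 : ∀ t, 0 ≤ t → 1 ≤ f t) :
    Monotone (fun k : ℕ => ⌊f k⌋₊) ∧ (∀ k : ℕ, 1 ≤ ⌊f k⌋₊ ∧ (⌊f k⌋₊ : ℝ) ≤ f k) ∧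
      ∀ k : ℕ, ((⌊f k⌋ : ℤ) : ℝ) = (⌊f k⌋₊ : ℝ) := by
  have h1 : ∀ k : ℕ, 1 ≤ f k := fun k => hf1 k k.cast_nonneg
  refine ⟨fun k l hkl => Nat.floor_mono (hf (mem_Ici.2 k.cast_nonneg) (mem_Ici.2 l.cast_nonneg)
    (by exact_mod_cast hkl)), fun k => ⟨Nat.le_floor (by simpa using h1 k),
    Nat.floor_le (zero_le_one.trans (h1 k))⟩, fun k => ?_⟩
  exact (natCast_floor_eq_intCast_floor (zero_le_one.trans (h1 k))).symm

variable [UniformSpace E] [IsUniformAddGroup E] [ContinuousSMul 𝕜 E] [CompleteSpace E] [T2Space E]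
  [TopologicalSpace.SeparableSpace E] [Nontrivial E]

/-- The criterion `exists_frequently_hypercyclic_vector` applied to `R 1` and to the averages
`∫₀¹ R t x dt` with `x ∈ E₀`, whose preimages under `R 1 ^ n` are the integrals
`∫_{n-1}^n σ t x dt`. -/
theorem IsRaySemigroup.isLFrequentlyHypercyclic {p : ℕ → Seminorm 𝕜 E} (hp : WithSeminorms p)
    (hmono : Monotone p) {R : ℝ → E →L[𝕜] E} (hR : IsRaySemigroup R) {f : ℝ → ℝ}
    (hf : MonotoneOn f (Ici 0)) (hf1 : ∀ t, 0 ≤ t → 1 ≤ f t) {E₀ : Set E} (hE₀ : Dense E₀)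
    {σ : ℝ → E → E} (hσE₀ : ∀ t, 0 ≤ t → ∀ x ∈ E₀, σ t x ∈ E₀)
    (h_right : ∀ t, 0 ≤ t → ∀ x ∈ E₀, R t (σ t x) = x)
    (h_ray : ∀ r t, 0 < t → t < r → ∀ x ∈ E₀,
      σ r (R t x) = σ (r - t) x ∧ R t (σ r x) = σ (r - t) x)
    (h_B : ∀ c > 0, ∀ x ∈ E₀, UnconditionallyConvergentUniformly {k : ℕ | 1 ≤ k} fun n k =>
      if n ≤ k then bochnerIntegral 𝕜 (shiftedIntervalB f 0 k n) (fun t => R (c * t) x) else 0)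
    {D : Set ℝ} (hD : Ici 0 ⊆ D)
    (h_A_int : ∀ x ∈ E₀, ∀ k n : ℕ, 1 ≤ k → 1 ≤ n →
      BochnerIntegrableOn 𝕜 {t ∈ intervalA f k n | t ∈ D} fun t => σ t x)
    (h_A : ∀ x ∈ E₀, UnconditionallyConvergentUniformly {k : ℕ | 1 ≤ k} fun n k =>
      bochnerIntegral 𝕜 {t ∈ intervalA f k n | t ∈ D} fun t => σ t x) :
    IsLFrequentlyHypercyclic (fun k : ℕ => f k) (R 1) := by
  have hpoly : PolynormableSpace 𝕜 E := hp.toPolynormableSpace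
  have hfc : FirstCountableTopology E := hp.firstCountableTopology
  have hcg : (uniformity E).IsCountablyGenerated :=
    IsUniformAddGroup.uniformity_countably_generated
  have hsc : SecondCountableTopology E := UniformSpace.secondCountable_of_separable E
  obtain ⟨hamono, ha, hfloor⟩ := natFloor_spec hf hf1
  set a : ℕ → ℕ := fun k => ⌊f k⌋₊ with ha_def
  obtain ⟨Q, hQ⟩ := hR.exists_average
  -- The backward integrals are translates of averages, at every speed `c`.
  have hBeq : ∀ c > 0, ∀ x y, HasWeakIntegral 𝕜 (Icc 0 1) (fun t => R (c * t) x) y →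
      ∀ n k : ℕ, bochnerIntegral 𝕜 (shiftedIntervalB f 0 k n) (fun t => R (c * t) x) =
        R (c * (a k - a (k - n) : ℕ)) y := by
    intro c hc x y hy n k
    have hRc := hR.comp_mul_left hc.le
    have e : shiftedIntervalB f 0 k n =
        Icc ((a k - a (k - n) : ℕ) : ℝ) ((a k - a (k - n) : ℕ) + 1) := by
      rw [shiftedIntervalB, hfloor, hfloor, Nat.cast_sub (hamono (Nat.sub_le k n))]
      simp only [zero_add, ha_def]
    rw [e]
    exact (hRc.bochnerIntegrableOn (Nat.cast_nonneg _) x).hasWeakIntegral.unique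
      (hRc.hasWeakIntegral_translate hy (Nat.cast_nonneg _))
  have hbwd : ∀ x ∈ E₀, UnconditionallyConvergentUniformly {k : ℕ | 1 ≤ k}
      fun n k => if n ≤ k then (R 1 ^ (a k - a (k - n))) (Q x) else 0 := by
    intro x hx
    refine (h_B 1 one_pos x hx).congr_of_ge (N₀ := 0) fun n _ k _ => ?_
    rw [hBeq 1 one_pos x (Q x) (by simpa using hQ x), one_mul, hR.pow_one_eq]
  have hdense : Dense (Q '' E₀) := by
    have hr : DenseRange Q := hR.denseRange_average hE₀ (fun j x hx y hy U hU => by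
      obtain ⟨N, hN1, hN⟩ := h_B ((1 / 2) ^ j) (by positivity) x hx U hU
      have h1 := hN {N} (by simp) N hN1
      simp only [Finset.sum_singleton, le_refl, if_true] at h1
      rw [hBeq _ (by positivity) x y hy] at h1
      exact ⟨_, h1⟩) hQ
    exact hr.dense_image Q.continuous hE₀
  obtain ⟨s, hsub, hsc', hsd⟩ := hdense.exists_countable_dense_subset
  obtain ⟨z, hz⟩ := hsc'.exists_eq_range hsd.nonempty
  have hpre : ∀ l, ∃ x ∈ E₀, Q x = z l := fun l => hsub (hz ▸ mem_range_self l)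
  choose w hwE₀ hw using hpre
  -- Every average is listed infinitely often.
  set x : ℕ → E := fun l => w (Nat.unpair l).1 with hx_def
  have hxE₀ : ∀ l, x l ∈ E₀ := fun l => hwE₀ _
  have hfreq : ∀ V : Set E, IsOpen V → V.Nonempty → ∃ c ∈ V, ∃ᶠ l in atTop, Q (x l) = c := by
    intro V hV hVne
    obtain ⟨c, hcV, hcs⟩ := hsd.exists_mem_open hV hVne
    rw [hz] at hcV
    obtain ⟨i, rfl⟩ := hcV
    refine ⟨z i, hcs, frequently_atTop.2 fun N => ⟨Nat.pair i N, Nat.right_le_pair i N, ?_⟩⟩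
    simp only [hx_def, Nat.unpair_pair, hw]
  obtain ⟨N, hN1, hgrow⟩ : ∃ N ≥ 1, ∀ n ≥ N, ∀ k ≥ 1, a k < a (k + n) := by
    obtain ⟨y, hy⟩ := exists_ne (0 : E)
    obtain ⟨c, hc0, hc⟩ := hfreq {0}ᶜ isOpen_compl_singleton ⟨y, hy⟩
    obtain ⟨l, hl⟩ := hc.exists
    exact exists_forall_lt_of_unconditionallyConvergentUniformly hamono (hl ▸ hc0)
      (hbwd (x l) (hxE₀ l))
  have hAset : ∀ k n : ℕ, a k < a (k + n) → {t ∈ intervalA f k n | t ∈ D} =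
      Icc ((a (k + n) : ℝ) - a k - 1) ((a (k + n) : ℝ) - a k) := by
    intro k n hlt
    have h1 : (a k : ℝ) + 1 ≤ a (k + n) := by exact_mod_cast hlt
    rw [intervalA, hfloor, hfloor]
    ext t
    simp only [mem_ofPred_eq, ha_def]
    refine ⟨fun h => h.1, fun h => ⟨h, hD ?_⟩⟩
    have := h.1
    simp only [ha_def] at h1
    exact mem_Ici.2 (by linarith)
  have ha1 : ∀ k, (1 : ℝ) ≤ a k := fun k => by exact_mod_cast (ha k).1
  -- `σ t x = σ (t - a 1) (σ (a 1) x)` expresses the integral of `σ t x` over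
  -- `[a n - 1, a n]` by an integral that occurs for `k = 1`.
  set v : ℕ → ℕ → E := fun l n => bochnerIntegral 𝕜 {t ∈ intervalA f 1 (n - 1) | t ∈ D}
    fun t => σ t (σ (a 1) (x l)) with hv_def
  have hσx : ∀ l, σ (a 1) (x l) ∈ E₀ := fun l => hσE₀ _ (Nat.cast_nonneg _) _ (hxE₀ l)
  have hvw : ∀ l, ∀ n ≥ N + 1,
      HasWeakIntegral 𝕜 (Icc ((a n : ℝ) - 1) (a n)) (fun t => σ t (x l)) (v l n) := by
    intro l n hn
    have hn' : 1 + (n - 1) = n := by omega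
    have hlt := hgrow (n - 1) (by omega) 1 le_rfl
    have h1 := (h_A_int _ (hσx l) 1 (n - 1) le_rfl (by omega)).hasWeakIntegral
    rw [hAset 1 (n - 1) hlt, hn'] at h1
    rw [hn'] at hlt
    have h2 : (a 1 : ℝ) + 1 ≤ a n := by exact_mod_cast hlt
    have h3 := h1.comp_sub_right (a 1)
    rw [sub_add_cancel, show (a n : ℝ) - a 1 - 1 + a 1 = a n - 1 by ring] at h3
    simp only [hv_def]
    rw [hAset 1 (n - 1) (by rwa [hn']), hn']
    refine h3.congr_Ioc fun t ht => ?_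
    have h0 : (0 : ℝ) < a 1 := zero_lt_one.trans_le (ha1 1)
    rw [← (h_ray t (a 1) h0 (by linarith [ht.1]) _ (hσx l)).1,
      h_right _ h0.le _ (hxE₀ l)]
  have hv : ∀ l, ∀ n ≥ N + 1, (R 1 ^ a n) (v l n) = Q (x l) := by
    intro l n hn
    have h1 := ((hvw l n hn).map (R (a n))).comp_sub_left (a n)
    rw [sub_self, sub_sub_cancel] at h1
    rw [hR.pow_one_eq]
    refine h1.unique ((hQ (x l)).congr_Ioc fun t ht => ?_)
    have h0 : 0 ≤ (a n : ℝ) - t := by linarith [ht.2, ha1 n]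
    have h2 := hR.add_apply ht.1.le h0 (σ (a n - t) (x l))
    rw [h_right _ h0 _ (hxE₀ l), add_sub_cancel] at h2
    exact h2.symm
  have hfwd : ∀ l, UnconditionallyConvergentUniformly {k : ℕ | 1 ≤ k}
      fun n k => (R 1 ^ a k) (v l (k + n)) := by
    intro l
    refine (h_A (x l) (hxE₀ l)).congr_of_ge (N₀ := N) fun n hn k hk => ?_
    have hk : 1 ≤ k := hk
    have hlt := hgrow n hn k hk
    have h1 := (h_A_int _ (hxE₀ l) k n hk (by omega)).hasWeakIntegral
    rw [hAset k n hlt] at h1 ⊢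
    have hlt' : (a k : ℝ) + 1 ≤ a (k + n) := by exact_mod_cast hlt
    have h0 : (0 : ℝ) < a k := zero_lt_one.trans_le (ha1 k)
    have h2 := ((hvw l (k + n) (by omega)).map (R (a k))).comp_sub_right (-(a k : ℝ))
    rw [show (a (k + n) : ℝ) - 1 + -(a k : ℝ) = a (k + n) - a k - 1 by ring,
      ← sub_eq_add_neg] at h2
    rw [hR.pow_one_eq]
    refine h1.unique (h2.congr_Ioc fun t ht => ?_)
    have h3 : 0 < t := by linarith [ht.1]
    rw [sub_neg_eq_add, (h_ray (t + a k) (a k) h0 (by linarith) _ (hxE₀ l)).2,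
      add_sub_cancel_right]
  obtain ⟨ξ, hξ⟩ := exists_frequently_hypercyclic_vector hp hmono (R 1) hamono
    (y := fun l => Q (x l)) (v := v) (k₀ := N + 1) (by omega) hfreq hv
    (fun l => (h_A _ (hσx l)).comp_sub_one (show 1 ≤ 1 from le_rfl)) hfwd
    (fun l => hbwd (x l) (hxE₀ l)) (fun k hk => hgrow (N + 1) (by omega) k hk)
  refine ⟨ξ, fun V hV hVne => ?_⟩
  obtain ⟨q, g, hg, hgV⟩ := hξ V hV hVne
  exact lowerSeqDensity_pos_of_strictMono hf ha hg (fun i => ⟨(hgV i).1, (hgV i).2.1⟩)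
    fun i => (hgV i).2.2

end TimeOne

/-! ### The geometry of the index sets -/

namespace ComplexSector

theorem ofReal_mul_mem (Δ : ComplexSector) {t : ℝ} (ht : 0 ≤ t) {z : ℂ} (hz : z ∈ Δ.carrier) :
    (t : ℂ) * z ∈ Δ.carrier := by
  cases Δ with
  | halfLine =>
    obtain ⟨s, hs, rfl⟩ := hz
    exact ⟨t * s, mul_nonneg ht hs, by push_cast; rfl⟩
  | line =>
    obtain ⟨s, rfl⟩ := hz
    exact ⟨t * s, by push_cast; rfl⟩
  | plane => trivial
  | sector α hα =>
    obtain ⟨r, θ, hr, h1, h2, rfl⟩ := hz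
    exact ⟨t * r, θ, mul_nonneg ht hr, h1, h2, by push_cast; ring⟩

theorem one_mem (Δ : ComplexSector) : (1 : ℂ) ∈ Δ.carrier := by
  cases Δ with
  | halfLine => exact ⟨1, zero_le_one, by simp⟩
  | line => exact ⟨1, by simp⟩
  | plane => trivial
  | sector α hα => exact ⟨1, 0, zero_le_one, by linarith [hα.1], hα.1.le, by simp⟩

theorem ofReal_mem (Δ : ComplexSector) {t : ℝ} (ht : 0 ≤ t) : (t : ℂ) ∈ Δ.carrier := by
  simpa using Δ.ofReal_mul_mem ht Δ.one_mem

/-- `K` is a compact set of small times near `0` in `Δ` that contains sets of positive measure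
arbitrarily close to `0`, all of whose translates by natural numbers stay in `Δ` and keep their
measure. -/
def IsStartingSet (Δ : ComplexSector) (K : Set ℂ) : Prop :=
  IsCompact K ∧ K ⊆ Δ.carrier ∧ ∀ δ > 0, ∃ D : Set ℂ, MeasurableSet D ∧ D ⊆ K ∧
    (∀ z ∈ D, ‖z‖ ≤ δ) ∧ ∃ β : ℝ≥0∞, 0 < β ∧ ∀ n : ℕ,
      (fun z : ℂ => z - n) ⁻¹' D ⊆ Δ.carrier ∧ Δ.measure ((fun z : ℂ => z - n) ⁻¹' D) = β

theorem isStartingSet_of_line {Δ : ComplexSector} {s : Set ℝ} (hs : Ici 0 ⊆ s)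
    (hΔ : Δ.measure = Measure.map Complex.ofReal (volume.restrict s)) :
    Δ.IsStartingSet (Complex.ofReal '' Icc 0 1) := by
  refine ⟨isCompact_Icc.image Complex.continuous_ofReal, ?_, fun δ hδ => ?_⟩
  · rintro _ ⟨t, ht, rfl⟩
    exact Δ.ofReal_mem ht.1
  have hε : 0 < min δ 1 := lt_min hδ one_pos
  refine ⟨Complex.ofReal '' Icc 0 (min δ 1),
    (isCompact_Icc.image Complex.continuous_ofReal).measurableSet,
    image_mono (Icc_subset_Icc le_rfl (min_le_right _ _)), ?_, ENNReal.ofReal (min δ 1),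
    ENNReal.ofReal_pos.2 hε, fun n => ?_⟩
  · rintro _ ⟨t, ht, rfl⟩
    rw [Complex.norm_real, Real.norm_of_nonneg ht.1]
    exact ht.2.trans (min_le_left _ _)
  have hmeas : MeasurableSet ((fun z : ℂ => z - n) ⁻¹' (Complex.ofReal '' Icc 0 (min δ 1))) :=
    (measurable_id.sub_const _) (isCompact_Icc.image Complex.continuous_ofReal).measurableSet
  have hpre : Complex.ofReal ⁻¹' ((fun z : ℂ => z - n) ⁻¹' (Complex.ofReal '' Icc 0 (min δ 1))) =
      Icc (n : ℝ) (n + min δ 1) := by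
    ext t
    simp only [mem_preimage, mem_image, mem_Icc]
    constructor
    · rintro ⟨r, hr, h⟩
      have h' : r = t - n := by exact_mod_cast h
      constructor <;> linarith [hr.1, hr.2]
    · intro ht
      exact ⟨t - n, ⟨by linarith [ht.1], by linarith [ht.2]⟩, by push_cast; rfl⟩
  refine ⟨?_, ?_⟩
  · rintro z ⟨t, ht, h⟩
    have : z = ((t + n : ℝ) : ℂ) := by
      push_cast
      rw [h]
      ring
    rw [this]
    exact Δ.ofReal_mem (add_nonneg ht.1 n.cast_nonneg)
  · have hsub : Icc (n : ℝ) (n + min δ 1) ⊆ s := fun t ht => hs (n.cast_nonneg.trans ht.1)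
    rw [hΔ, Measure.map_apply Complex.continuous_ofReal.measurable hmeas, hpre,
      Measure.restrict_eq_self _ hsub, Real.volume_Icc, add_sub_cancel_left]

theorem isStartingSet_of_cone {Δ : ComplexSector} {κ : ℝ} (hκ : 0 < κ)
    (hC : {z : ℂ | 0 ≤ z.re ∧ |z.im| ≤ κ * z.re} ⊆ Δ.carrier)
    (hΔ : ∀ B : Set ℂ, MeasurableSet B → B ⊆ {z : ℂ | 0 ≤ z.re ∧ |z.im| ≤ κ * z.re} →
      Δ.measure B = volume B) :
    Δ.IsStartingSet ({z : ℂ | 0 ≤ z.re ∧ |z.im| ≤ κ * z.re} ∩ Metric.closedBall 0 1) := by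
  set C : Set ℂ := {z : ℂ | 0 ≤ z.re ∧ |z.im| ≤ κ * z.re} with hC_def
  have hCc : IsClosed C :=
    (isClosed_le continuous_const Complex.continuous_re).inter
      (isClosed_le (Complex.continuous_im.abs) (continuous_const.mul Complex.continuous_re))
  refine ⟨(isCompact_closedBall 0 1).inter_left hCc, inter_subset_left.trans hC, fun δ hδ => ?_⟩
  have hε : 0 < min δ 1 := lt_min hδ one_pos
  set ε := min δ 1
  have hDm : MeasurableSet (C ∩ Metric.closedBall 0 ε) :=
    hCc.measurableSet.inter Metric.isClosed_closedBall.measurableSet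
  refine ⟨C ∩ Metric.closedBall 0 ε, hDm,
    inter_subset_inter_right _ (Metric.closedBall_subset_closedBall (min_le_right _ _)),
    fun z hz => (mem_closedBall_zero_iff.1 hz.2).trans (min_le_left _ _),
    volume (C ∩ Metric.closedBall 0 ε), ?_, fun n => ?_⟩
  · refine Measure.measure_pos_of_mem_nhds (x := ((ε / 2 : ℝ) : ℂ)) volume
      (inter_mem ?_ ?_)
    · have hopen : IsOpen {z : ℂ | 0 < z.re ∧ |z.im| < κ * z.re} :=
        (isOpen_lt continuous_const Complex.continuous_re).inter
          (isOpen_lt (Complex.continuous_im.abs) (continuous_const.mul Complex.continuous_re))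
      refine mem_of_superset (hopen.mem_nhds ?_) fun z hz => ⟨hz.1.le, hz.2.le⟩
      constructor
      · rw [Complex.ofReal_re]; positivity
      · rw [Complex.ofReal_re, Complex.ofReal_im, abs_zero]; positivity
    · refine mem_of_superset (Metric.isOpen_ball.mem_nhds ?_) Metric.ball_subset_closedBall
      rw [mem_ball_zero_iff, Complex.norm_real, Real.norm_of_nonneg (by positivity)]
      linarith
  · have hsub : (fun z : ℂ => z - n) ⁻¹' (C ∩ Metric.closedBall 0 ε) ⊆ C := by
      rintro z ⟨⟨h1, h2⟩, -⟩
      simp only [Complex.sub_re, Complex.natCast_re, Complex.sub_im, Complex.natCast_im,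
        sub_zero] at h1 h2
      have hn : (0 : ℝ) ≤ n := n.cast_nonneg
      exact ⟨by linarith, h2.trans (by gcongr; linarith)⟩
    refine ⟨hsub.trans hC, ?_⟩
    rw [hΔ _ (measurable_sub_const (n : ℂ) hDm) hsub]
    simpa [sub_eq_add_neg] using
      measure_preimage_add_right volume (-(n : ℂ)) (C ∩ Metric.closedBall 0 ε)

theorem cone_subset_sector {α : ℝ} (hα : 0 < α ∧ α ≤ Real.pi / 2) :
    {z : ℂ | 0 ≤ z.re ∧ |z.im| ≤ Real.sin α * z.re} ⊆ (sector α hα).carrier := by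
  rintro z ⟨h1, h2⟩
  have hs : 0 ≤ Real.sin α :=
    (Real.sin_pos_of_pos_of_lt_pi hα.1 (by linarith [Real.pi_pos, hα.2])).le
  have h3 : |z.im / ‖z‖| ≤ Real.sin α := by
    rw [abs_div, abs_norm]
    refine div_le_of_le_mul₀ (norm_nonneg z) hs (h2.trans ?_)
    gcongr
    exact Complex.re_le_norm z
  obtain ⟨h4, h5⟩ := abs_le.1 h3
  refine ⟨‖z‖, z.arg, norm_nonneg z, ?_, ?_, (Complex.norm_mul_exp_arg_mul_I z).symm⟩
  · rw [Complex.arg_of_re_nonneg h1]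
    rw [← Real.sin_neg] at h4
    have h6 := Real.monotone_arcsin h4
    rwa [Real.arcsin_sin (by linarith [hα.2]) (by linarith [hα.1, Real.pi_pos])] at h6
  · rw [Complex.arg_of_re_nonneg h1]
    have h6 := Real.monotone_arcsin h5
    rwa [Real.arcsin_sin (by linarith [hα.1, Real.pi_pos]) hα.2] at h6

theorem exists_isStartingSet (Δ : ComplexSector) : ∃ K, Δ.IsStartingSet K := by
  cases Δ with
  | halfLine => exact ⟨_, isStartingSet_of_line subset_rfl rfl⟩
  | line => exact ⟨_, isStartingSet_of_line (subset_univ _) (by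
      rw [Measure.restrict_univ]; rfl)⟩
  | plane => exact ⟨_, isStartingSet_of_cone one_pos (subset_univ _) fun B _ _ => rfl⟩
  | sector α hα =>
    refine ⟨_, isStartingSet_of_cone (Real.sin_pos_of_pos_of_lt_pi hα.1
      (by linarith [Real.pi_pos, hα.2])) (cone_subset_sector hα) fun B hB hBC => ?_⟩
    exact Measure.restrict_eq_self _ (hBC.trans (cone_subset_sector hα))

end ComplexSector

/-! ### From the time-one operator to the semigroup -/

section Transfer

variable {𝕜 : Type*} [RCLike 𝕜] {E : Type*} [AddCommGroup E] [Module 𝕜 E]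

theorem IsC0Semigroup.pow_one_eq [TopologicalSpace E] {Δ : ComplexSector} {T : ℂ → E →L[𝕜] E}
    (hT : IsC0Semigroup Δ T) (n : ℕ) : T 1 ^ n = T n := by
  induction n with
  | zero => rw [pow_zero, Nat.cast_zero, hT.map_zero]; rfl
  | succ n ih =>
    rw [pow_succ, ih, Nat.cast_succ,
      hT.map_add n (by simpa using Δ.ofReal_mem n.cast_nonneg) 1 Δ.one_mem]
    rfl

theorem IsC0Semigroup.isRaySemigroup [TopologicalSpace E] {Δ : ComplexSector} {T : ℂ → E →L[𝕜] E}
    (hT : IsC0Semigroup Δ T) {t₀ : ℂ} (ht₀ : t₀ ∈ Δ.carrier) :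
    IsRaySemigroup fun t : ℝ => T (t * t₀) where
  map_zero := by simpa using hT.map_zero
  map_add t ht s hs := by
    push_cast
    rw [add_mul]
    exact hT.map_add _ (Δ.ofReal_mul_mem ht ht₀) _ (Δ.ofReal_mul_mem hs ht₀)
  continuousOn x := (hT.continuousOn x).comp (by fun_prop) fun t ht => Δ.ofReal_mul_mem ht ht₀

theorem IsC0Semigroup.halfLine_comp_mul [TopologicalSpace E] {Δ : ComplexSector}
    {T : ℂ → E →L[𝕜] E} (hT : IsC0Semigroup Δ T) {e : ℂ} (he : e ∈ Δ.carrier) :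
    IsC0Semigroup ComplexSector.halfLine fun z => T (z * e) where
  map_zero := by simpa using hT.map_zero
  map_add := by
    rintro _ ⟨t, ht, rfl⟩ _ ⟨s, hs, rfl⟩
    rw [add_mul]
    exact hT.map_add _ (Δ.ofReal_mul_mem ht he) _ (Δ.ofReal_mul_mem hs he)
  continuousOn x := (hT.continuousOn x).comp (by fun_prop) (by
    rintro _ ⟨t, ht, rfl⟩
    exact Δ.ofReal_mul_mem ht he)

/-- Whenever `T n x` is close to a point of `V`, local equicontinuity keeps `T (n + z) x` in `V`
for all small `z` in `Δ`; the sets `n + D` of such times are pairwise disjoint and have the same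
positive measure. -/
theorem IsC0Semigroup.isFFrequentlyHypercyclic [UniformSpace E] [IsUniformAddGroup E]
    [ContinuousSMul 𝕜 E] [CompleteSpace E] [PolynormableSpace 𝕜 E] [FirstCountableTopology E]
    {Δ : ComplexSector} {T : ℂ → E →L[𝕜] E} (hT : IsC0Semigroup Δ T) {f : ℝ → ℝ}
    (hf : MonotoneOn f (Ici 0)) (h : IsLFrequentlyHypercyclic (fun k : ℕ => f k) (T 1)) :
    IsFFrequentlyHypercyclic Δ f T := by
  classical
  obtain ⟨x, hx⟩ := h
  refine ⟨x, fun V hV ⟨v, hv⟩ => ?_⟩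
  obtain ⟨K, hKc, hKΔ, hK⟩ := Δ.exists_isStartingSet
  obtain ⟨s, ε, hε, hsub⟩ := ((PolynormableSpace.withSeminorms 𝕜 E).mem_nhds_iff v V).1
    (hV.mem_nhds hv)
  set q : Seminorm 𝕜 E := s.sup fun p : {p : Seminorm 𝕜 E // Continuous p} => p.1
  have hqc : Continuous q := Seminorm.continuous_finsetSup fun p _ => p.2
  obtain ⟨r, hr, hqr⟩ := exists_seminorm_bound_of_isCompact hKc
    (fun x => (hT.continuousOn x).mono hKΔ) hqc
  obtain ⟨δ, hδ0, hδ⟩ : ∃ δ > 0, ∀ z ∈ Δ.carrier, ‖z‖ < δ → q (T z v - v) < ε / 2 := by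
    have h0 : (0 : ℂ) ∈ Δ.carrier := by simpa using Δ.ofReal_mem le_rfl
    have h1 : Tendsto (fun z => T z v) (𝓝[Δ.carrier] 0) (𝓝 v) := by
      simpa [ContinuousWithinAt, hT.map_zero] using hT.continuousOn v 0 h0
    have h2 : Tendsto (fun z => q (T z v - v)) (𝓝[Δ.carrier] 0) (𝓝 0) :=
      (hqc.tendsto' 0 0 (_root_.map_zero q)).comp (by simpa using h1.sub_const v)
    obtain ⟨δ, hδ, hb⟩ := Metric.mem_nhdsWithin_iff.1
      (h2.eventually (gt_mem_nhds (half_pos hε)))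
    exact ⟨δ, hδ, fun z hz hzδ => hb ⟨mem_ball_zero_iff.2 hzδ, hz⟩⟩
  obtain ⟨D, hDm, hDK, hDδ, β, hβ, hDβ⟩ := hK (min (δ / 2) (1 / 3)) (by positivity)
  set V' : Set E := {y | r (y - v) < ε / 2} with hV'
  have hV'o : IsOpen V' := isOpen_lt (hr.comp (continuous_id.sub continuous_const)) continuous_const
  have hstay : ∀ z ∈ D, ∀ y ∈ V', T z y ∈ V := by
    intro z hz y hy
    apply hsub
    rw [Seminorm.mem_ball]
    have h1 := hqr z (hDK hz) (y - v)
    have h2 := hδ z (hKΔ (hDK hz))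
      ((hDδ z hz).trans_lt ((min_le_left _ _).trans_lt (half_lt_self hδ0)))
    have h3 : r (y - v) < ε / 2 := hy
    have h4 : T z y - v = T z (y - v) + (T z v - v) := by rw [map_sub]; abel
    rw [h4]
    exact (map_add_le_add q _ _).trans_lt (by linarith)
  set A : Set ℂ := {t | t ∈ Δ.carrier ∧ T t x ∈ V} with hA
  have hmem : ∀ n : ℕ, (T 1 ^ n) x ∈ V' → (fun z : ℂ => z - n) ⁻¹' D ⊆ A := by
    intro n hn z hz
    refine ⟨(hDβ n).1 hz, ?_⟩
    have h1 := hstay _ hz _ hn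
    rw [hT.pow_one_eq] at h1
    have h2 := hT.map_add (z - n) (hKΔ (hDK hz)) n (by simpa using Δ.ofReal_mem n.cast_nonneg)
    rw [sub_add_cancel] at h2
    rw [h2]
    exact h1
  have hdisj : Pairwise (Function.onFun Disjoint fun n : ℕ => (fun z : ℂ => z - n) ⁻¹' D) := by
    intro m n hmn
    refine Set.disjoint_left.2 fun z hm hn => hmn ?_
    have h1 := (hDδ _ hm).trans (min_le_right _ _)
    have h2 := (hDδ _ hn).trans (min_le_right _ _)
    have h3 : ‖((m : ℤ) - (n : ℤ) : ℂ)‖ < 1 := by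
      have e : ((m : ℤ) - (n : ℤ) : ℂ) = (z - n) - (z - m) := by push_cast; ring
      rw [e]
      refine (norm_sub_le _ _).trans_lt (by linarith)
    rw [← Int.cast_sub, Complex.norm_intCast] at h3
    have h4 : |(m : ℤ) - n| < 1 := by exact_mod_cast h3
    have h5 := Int.abs_lt_one_iff.1 h4
    omega
  have hpos := hx V' hV'o ⟨v, by simp [hV', hε]⟩
  obtain ⟨c, hc0, hc⟩ := ENNReal.lt_iff_exists_nnreal_btwn.1 hpos
  have hc0' : (0 : ℝ) < c := by exact_mod_cast hc0
  have hcount := eventually_lt_of_lt_liminf hc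
  set S : ℕ → Set ℕ := fun k => {j ∈ {n | (T 1 ^ n) x ∈ V'} | 1 ≤ j ∧ (j : ℝ) ≤ f k} with hS
  have hSfin : ∀ k, (S k).Finite := fun k =>
    (Set.finite_Iic ⌊f k⌋₊).subset fun j hj => Nat.le_floor hj.2.2
  -- The largest element of `S k` is discarded, since `n + D` may leave the ball of radius `f k`.
  have hmeasure : ∀ t : ℝ, 0 ≤ t → (((S ⌊t⌋₊).ncard - 1 : ℕ) : ℝ≥0∞) * β ≤
      Δ.measure (A ∩ Δ.truncation (f t)) := by
    intro t ht
    set k := ⌊t⌋₊ with hk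
    have hfk : f k ≤ f t := hf (mem_Ici.2 k.cast_nonneg) (mem_Ici.2 ht) (Nat.floor_le ht)
    set F := (hSfin k).toFinset with hF
    have hcard : (S k).ncard = F.card := Set.ncard_eq_toFinset_card _ _
    rcases F.eq_empty_or_nonempty with h0 | hne
    · simp [hcard, h0]
    set M := F.max' hne
    have hsubset : (⋃ n ∈ F.erase M, (fun z : ℂ => z - n) ⁻¹' D) ⊆ A ∩ Δ.truncation (f t) := by
      refine iUnion₂_subset fun n hn z hz => ?_
      have hnF := (hSfin k).mem_toFinset.1 (Finset.mem_of_mem_erase hn)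
      have hMF := (hSfin k).mem_toFinset.1 (F.max'_mem hne)
      have hlt : n + 1 ≤ M := lt_of_le_of_ne (F.le_max' n (Finset.mem_of_mem_erase hn))
        (Finset.ne_of_mem_erase hn)
      have hlt' : (n : ℝ) + 1 ≤ M := by exact_mod_cast hlt
      refine ⟨hmem n hnF.1 hz, (hDβ n).1 hz, ?_⟩
      have h1 := (hDδ _ hz).trans (min_le_right _ _)
      have h2 : ‖z‖ ≤ ‖z - n‖ + ‖(n : ℂ)‖ := by
        simpa using norm_add_le (z - n) (n : ℂ)
      rw [Complex.norm_natCast] at h2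
      have h3 : (M : ℝ) ≤ f k := hMF.2.2
      simp only at h1
      linarith
    calc (((S k).ncard - 1 : ℕ) : ℝ≥0∞) * β = ∑ n ∈ F.erase M, β := by
          rw [Finset.sum_const, Finset.card_erase_of_mem (F.max'_mem hne), hcard, nsmul_eq_mul]
      _ = ∑ n ∈ F.erase M, Δ.measure ((fun z : ℂ => z - n) ⁻¹' D) :=
          Finset.sum_congr rfl fun n _ => (hDβ n).2.symm
      _ = Δ.measure (⋃ n ∈ F.erase M, (fun z : ℂ => z - n) ⁻¹' D) :=
          (measure_biUnion_finset (fun m _ n _ hmn => hdisj hmn)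
            fun n _ => (measurable_id.sub_const _) hDm).symm
      _ ≤ _ := measure_mono hsubset
  have hγ : 0 < ENNReal.ofReal (c / 4) * β :=
    ENNReal.mul_pos (ENNReal.ofReal_pos.2 (by positivity)).ne' hβ.ne'
  refine hγ.trans_le (le_liminf_of_le (by isBoundedDefault) ?_)
  filter_upwards [tendsto_nat_floor_atTop.eventually hcount, eventually_ge_atTop 2,
    eventually_ge_atTop (4 / (c : ℝ))] with t hct ht2 htc
  have ht0 : 0 < t := by linarith
  have hkt : t / 2 ≤ (⌊t⌋₊ : ℝ) := by linarith [Nat.lt_floor_add_one t]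
  have hk0 : ((⌊t⌋₊ : ℕ) : ℝ≥0∞) ≠ 0 := by
    have : (0 : ℝ) < ⌊t⌋₊ := by linarith
    exact_mod_cast this.ne'
  have h1 : (c : ℝ) * ⌊t⌋₊ ≤ (S ⌊t⌋₊).ncard := by
    have h2 := (ENNReal.le_div_iff_mul_le (Or.inl hk0) (Or.inl (ENNReal.natCast_ne_top _))).1 hct.le
    exact_mod_cast h2
  have h2 : (c : ℝ) / 4 * t ≤ ((S ⌊t⌋₊).ncard - 1 : ℕ) := by
    have h3 : ((S ⌊t⌋₊).ncard : ℝ) - 1 ≤ ((S ⌊t⌋₊).ncard - 1 : ℕ) := by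
      rw [sub_le_iff_le_add]
      norm_cast
      omega
    rw [div_le_iff₀ hc0'] at htc
    nlinarith
  rw [ENNReal.le_div_iff_mul_le (Or.inl (ENNReal.ofReal_pos.2 ht0).ne')
    (Or.inl ENNReal.ofReal_ne_top)]
  refine le_trans ?_ (hmeasure t ht0.le)
  calc ENNReal.ofReal (c / 4) * β * ENNReal.ofReal t = ENNReal.ofReal (c / 4 * t) * β := by
        rw [ENNReal.ofReal_mul (by positivity)]; ring
    _ ≤ (((S ⌊t⌋₊).ncard - 1 : ℕ) : ℝ≥0∞) * β := by
        gcongr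
        exact (ENNReal.ofReal_le_ofReal h2).trans_eq (ENNReal.ofReal_natCast _)

end Transfer

end

theorem theorem2p10 {𝕜 : Type*} [RCLike 𝕜]
    -- `E` is a nonzero separable Fréchet space over `𝕜`
    {E : Type*} [AddCommGroup E] [Module 𝕜 E] [UniformSpace E] [IsUniformAddGroup E]
    [ContinuousSMul 𝕜 E] [CompleteSpace E] [T2Space E] [TopologicalSpace.SeparableSpace E]
    [Nontrivial E]
    (p : ℕ → Seminorm 𝕜 E) (hp : WithSeminorms p) (hp_mono : Monotone p)
    (Δ : ComplexSector) (T : ℂ → E →L[𝕜] E) (hT : IsC0Semigroup Δ T)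
    (f : ℝ → ℝ) (hf_mono : MonotoneOn f (Set.Ici 0)) (hf_one : ∀ t, 0 ≤ t → 1 ≤ f t)
    (E₀ : Set E) (hE₀ : Dense E₀) (hTE₀ : ∀ t ∈ Δ.carrier, ∀ x ∈ E₀, T t x ∈ E₀)
    -- only the values `S t x` with `t ∈ Δ`, `x ∈ E₀` matter
    (S : ℂ → E → E) (hSE₀ : ∀ t ∈ Δ.carrier, ∀ x ∈ E₀, S t x ∈ E₀)
    (h_right : ∀ t ∈ Δ.carrier, ∀ x ∈ E₀, T t (S t x) = x)
    (h_ray : ∀ r ∈ Δ.carrier, ∀ t ∈ Δ.carrier, r ≠ 0 → t ≠ 0 → r.arg = t.arg → ‖t‖ < ‖r‖ →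
      ∀ x ∈ E₀, S r (T t x) = S (r - t) x ∧ T t (S r x) = S (r - t) x)
    (h_B : ∀ t₀ ∈ Δ.carrier, t₀ ≠ 0 → ∀ s : ℝ, 0 ≤ s → ∀ x ∈ E₀,
      UnconditionallyConvergentUniformly {k : ℕ | 1 ≤ k} (fun n k =>
        if n ≤ k then
          bochnerIntegral 𝕜 (shiftedIntervalB f s k n) (fun t : ℝ => T ((t : ℂ) * t₀) x)
        else 0))
    (h_A_int : ∀ t₀ ∈ Δ.carrier, t₀ ≠ 0 → ∀ x ∈ E₀, ∀ k n : ℕ, 1 ≤ k → 1 ≤ n →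
      BochnerIntegrableOn 𝕜 {t ∈ intervalA f k n | (t : ℂ) * t₀ ∈ Δ.carrier}
        (fun t : ℝ => S ((t : ℂ) * t₀) x))
    (h_A : ∀ t₀ ∈ Δ.carrier, t₀ ≠ 0 → ∀ x ∈ E₀,
      UnconditionallyConvergentUniformly {k : ℕ | 1 ≤ k} (fun n k =>
        bochnerIntegral 𝕜 {t ∈ intervalA f k n | (t : ℂ) * t₀ ∈ Δ.carrier}
          (fun t : ℝ => S ((t : ℂ) * t₀) x))) :
    IsFFrequentlyHypercyclic Δ f T ∧
    ∀ t₀ ∈ Δ.carrier, t₀ ≠ 0 →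
      IsFFrequentlyHypercyclic ComplexSector.halfLine f
        (fun z => T (z * Complex.exp (t₀.arg * Complex.I))) ∧
      IsLFrequentlyHypercyclic (fun k : ℕ => f k) (T t₀) := by
  have hpoly : PolynormableSpace 𝕜 E := hp.toPolynormableSpace
  have hfc : FirstCountableTopology E := hp.firstCountableTopology
  have hop : ∀ t₀ ∈ Δ.carrier, t₀ ≠ 0 → IsLFrequentlyHypercyclic (fun k : ℕ => f k) (T t₀) := by
    intro t₀ ht₀ ht₀0
    have hmem : ∀ t : ℝ, 0 ≤ t → (t : ℂ) * t₀ ∈ Δ.carrier := fun t ht =>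
      Δ.ofReal_mul_mem ht ht₀
    have hne : ∀ t : ℝ, 0 < t → (t : ℂ) * t₀ ≠ 0 := fun t ht =>
      mul_ne_zero (by exact_mod_cast ht.ne') ht₀0
    have h := (hT.isRaySemigroup ht₀).isLFrequentlyHypercyclic hp hp_mono hf_mono hf_one hE₀
      (σ := fun t => S (t * t₀)) (fun t ht => hSE₀ _ (hmem t ht))
      (fun t ht => h_right _ (hmem t ht))
      (fun r t ht htr x hx => by
        have hr := ht.trans htr
        have harg : ((r : ℂ) * t₀).arg = ((t : ℂ) * t₀).arg := by
          rw [Complex.arg_real_mul _ hr, Complex.arg_real_mul _ ht]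
        have hnorm : ‖(t : ℂ) * t₀‖ < ‖(r : ℂ) * t₀‖ := by
          rw [norm_mul, norm_mul, Complex.norm_real, Complex.norm_real,
            Real.norm_of_nonneg ht.le, Real.norm_of_nonneg hr.le]
          exact mul_lt_mul_of_pos_right htr (norm_pos_iff.2 ht₀0)
        simpa only [Complex.ofReal_sub, sub_mul] using
          h_ray _ (hmem r hr.le) _ (hmem t ht.le) (hne r hr) (hne t ht) harg hnorm x hx)
      (fun c hc x hx => by
        have e : ∀ t : ℝ, ((c * t : ℝ) : ℂ) * t₀ = t * (c * t₀) := fun t => by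
          push_cast; ring
        simpa only [e] using h_B _ (hmem c hc.le) (hne c hc) 0 le_rfl x hx)
      (D := {t : ℝ | (t : ℂ) * t₀ ∈ Δ.carrier}) (fun t ht => hmem t ht)
      (h_A_int t₀ ht₀ ht₀0) (h_A t₀ ht₀ ht₀0)
    simpa using h
  refine ⟨hT.isFFrequentlyHypercyclic hf_mono (hop 1 Δ.one_mem one_ne_zero),
    fun t₀ ht₀ ht₀0 => ⟨?_, hop t₀ ht₀ ht₀0⟩⟩
  have he : Complex.exp (t₀.arg * Complex.I) ∈ Δ.carrier := by
    have h1 := Δ.ofReal_mul_mem (inv_nonneg.2 (norm_nonneg t₀)) ht₀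
    have h2 : (‖t₀‖ : ℂ) ≠ 0 := by exact_mod_cast norm_ne_zero_iff.2 ht₀0
    nth_rewrite 2 [← Complex.norm_mul_exp_arg_mul_I t₀] at h1
    rwa [Complex.ofReal_inv, inv_mul_cancel_left₀ h2] at h1
  refine (hT.halfLine_comp_mul he).isFFrequentlyHypercyclic hf_mono ?_
  simpa only [one_mul] using hop _ he (Complex.exp_ne_zero _)
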